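/- Let $p,n\in\mathbb N$, $T=(T^1,\dots,T^p)$ with all $T^i>0$, and $T_0=[0,T^1]\times\cdots\times[0,T^p]\subset\mathbb R^p$. Let $C_T^\infty$ be the space of all $C^\infty$ functions $f:\mathbb R^p\to\mathbb R^n$ that are $T^i$-periodic in the $i$-th variable for every $i$. Let $H^1_T=W^{1,2}_T$ be the Hilbert space of all $u\in L^2(T_0,\mathbb R^n)$ that have a weak derivative $\frac{\partial u}{\partial t}=\bigl(\frac{\partial u}{\partial t^\alpha}\bigr)_{\alpha=1}^p$ with $\frac{\partial u}{\partial t^\alpha}\in L^2(T_0,\mathbb R^n)$, meaning $$\int_{T_0}\Bigl(u,\frac{\partial f}{\partial t^\alpha}\Bigr)dt=-\int_{T_0}\Bigl(\frac{\partial u}{\partial t^\alpha},f\Bigr)dt\qquad\text{for all } f\in C_T^\infty,\ \alpha=1,\dots,p,$$ with the scalar product $\langle u,w\rangle=\int_{T_0}\bigl[(u,w)+\sum_\alpha(\frac{\partial u}{\partial t^\alpha},\frac{\partial w}{\partial t^\alpha})\bigr]dt$. A function $w\in L^2(T_0,\mathbb R^n)$ is called the weak Laplacian $\Delta u$ of $u\in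 H^1_T$ if $$\int_{T_0}\sum_{\alpha}\Bigl(\frac{\partial u}{\partial t^\alpha},\frac{\partial f}{\partial t^\alpha}\Bigr)dt=-\int_{T_0}(w,f)\,dt\qquad\text{for all } f\in C_T^\infty.$$ Let $F:T_0\times\mathbb R^n\to\mathbb R$, $(t,u)\mapsto F(t,u)$, satisfy: 1. $F(\cdot,u)$ is measurable for every $u\in\mathbb R^n$, and $F(t,\cdot)$ is continuously differentiable for every $t\in T_0$; 2. there are $a\in C^1([0,\infty),[0,\infty))$ with $a'$ bounded from above and a continuous $b:T_0\to[0,\infty)$ such that $|F(t,u)|\le a(|u|)\,b(t)$ and $|\nabla_uF(t,u)|\le a(|u|)\,b(t)$ for all $t\in T_0$, $u\in\mathbb R^n$; 3. there is $g\in C^1(T_0,\mathbb R)$ such that $|\nabla_uF(t,u)|\le g(t)$ for all $t\in T_0$, $u\in\mathbb R^n$; 4. the functional $\varphi_1(u)=\int_{T_0}F(t,u(t))\,dt$ is (sequentially) weakly lower semicontinuous on $H^1_T$. Suppose moreover that $\int_{T_0}F(t,x)\,dt\to\infty$ as $|x|\to\infty$, $x\in\mathbb R^n$. Then the boundary value problem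 $$\Delta u(t)=\nabla_uF(t,u(t))\ \text{ on } T_0,\qquad u|_{S_i^-}=u|_{S_i^+},\quad \frac{\partial u}{\partial t}\Big|_{S_i^-}=\frac{\partial u}{\partial t}\Big|_{S_i^+},\quad i=1,\dots,p,$$ where $S_i^-=\{t\in T_0: t^i=0\}$ and $S_i^+=\{t\in T_0: t^i=T^i\}$, has at least one solution $u\in H^1_T$ that minimizes the action $$\varphi(u)=\int_{T_0}\Bigl[\tfrac12\Bigl|\frac{\partial u}{\partial t}\Bigr|^2+F(t,u(t))\Bigr]dt$$ over $H^1_T$. Here $\Delta u$ is the weak Laplacian (so that the equation holds almost everywhere on $T_0$), and the boundary conditions mean that $u$ and all $\frac{\partial u}{\partial t^\alpha}$ have traces in $L^2$ on the faces $S_i^\pm$ and that their traces on opposite faces coincide. A function $f\in L^2(T_0,\mathbb R^n)$ has the trace $\gamma\in L^2$ on the face $\{t\in T_0:t^i=c\}$, $c\in\{0,T^i\}$, if $h^{-1}\int_{\{t\in T_0:\,|t^i-c|\le h\}}|f(t)-\gamma((t^j)_{j\ne i})|\,dt\to0$ as $h\downarrow0$. -/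

import Mathlib

open MeasureTheory Filter Topology
open scoped ContDiff

noncomputable section

namespace PoissonGradient

/-- The space `ℝⁿ` of values of the fields, with its Euclidean norm. -/
abbrev E (n : ℕ) : Type := EuclideanSpace ℝ (Fin n)

/-- The space `ℝⁿᵖ` of Jacobi matrices `(∂u/∂t^α)_α`; its norm is the Euclidean (Frobenius) one. -/
abbrev J (p n : ℕ) : Type := PiLp 2 (fun _ : Fin p => E n)

/-- The parallelepiped `T₀ = [0, T¹] × ⋯ × [0, Tᵖ]`. -/
def box {p : ℕ} (T : Fin p → ℝ) : Set (Fin p → ℝ) := Set.Icc 0 T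

/-- Lebesgue measure on the parallelepiped. -/
abbrev boxMeasure {p : ℕ} (T : Fin p → ℝ) : Measure (Fin p → ℝ) := volume.restrict (box T)

/-- `C_T^∞`: smooth functions `ℝᵖ → ℝⁿ` that are `T^i`-periodic in the `i`-th variable, all `i`. -/
structure IsPeriodicTest {p n : ℕ} (T : Fin p → ℝ) (f : (Fin p → ℝ) → E n) : Prop where
  smooth : ContDiff ℝ ∞ f
  periodic : ∀ (i : Fin p) (t : Fin p → ℝ), f (t + Pi.single i (T i)) = f t

/-- The classical partial derivative `∂f/∂t^α`. -/
def pderiv {p n : ℕ} (α : Fin p) (f : (Fin p → ℝ) → E n) (t : Fin p → ℝ) : E n :=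
  fderiv ℝ f t (Pi.single α 1)

/-- `v = (v_α)_α` is the weak derivative `∂u/∂t` of `u`, tested against `C_T^∞`. -/
def HasWeakGradient {p n : ℕ} (T : Fin p → ℝ) (u : (Fin p → ℝ) → E n)
    (v : (Fin p → ℝ) → J p n) : Prop :=
  ∀ f : (Fin p → ℝ) → E n, IsPeriodicTest T f → ∀ α : Fin p,
    ∫ t in box T, inner ℝ (u t) (pderiv α f t) = - ∫ t in box T, inner ℝ (v t α) (f t)

theorem integrable_inner_continuous {p n : ℕ} (T : Fin p → ℝ) {u f : (Fin p → ℝ) → E n}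
    (hu : MemLp u 2 (boxMeasure T)) (hf : Continuous f) :
    Integrable (fun t => (inner ℝ (u t) (f t) : ℝ)) (boxMeasure T) := by
  have : IsFiniteMeasure (boxMeasure T) :=
    ⟨by simpa [boxMeasure, box] using (isCompact_Icc (a := (0 : Fin p → ℝ)) (b := T)).measure_lt_top⟩
  obtain ⟨C, hC⟩ := (isCompact_Icc (a := (0 : Fin p → ℝ)) (b := T)).exists_bound_of_continuousOn
    hf.continuousOn
  have hf2 : MemLp f 2 (boxMeasure T) :=
    MemLp.of_bound hf.aestronglyMeasurable C
      ((ae_restrict_iff' measurableSet_Icc).2 (Eventually.of_forall hC))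
  refine (L2.integrable_inner (𝕜 := ℝ) (hu.toLp u) (hf2.toLp f)).congr ?_
  filter_upwards [hu.coeFn_toLp, hf2.coeFn_toLp] with t h1 h2
  rw [h1, h2]

theorem IsPeriodicTest.continuous_pderiv {p n : ℕ} {T : Fin p → ℝ} {f : (Fin p → ℝ) → E n}
    (hf : IsPeriodicTest T f) (α : Fin p) : Continuous (pderiv α f) :=
  (hf.smooth.continuous_fderiv (by simp)).clm_apply continuous_const

theorem memLp_component {p n : ℕ} {T : Fin p → ℝ} (v : Lp (J p n) 2 (boxMeasure T))
    (α : Fin p) : MemLp (fun t => v t α) 2 (boxMeasure T) :=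
  (PiLp.proj (𝕜 := ℝ) 2 (fun _ : Fin p => E n) α).comp_memLp' (Lp.memLp v)

/-- The ambient Hilbert space of pairs `(u, v)` with `u ∈ L²(T₀, ℝⁿ)` and `v ∈ L²(T₀, ℝⁿᵖ)`, with
inner product `∫ (u, u') + ∫ ∑_α (v_α, v'_α)`. -/
abbrev PairSpace {p : ℕ} (n : ℕ) (T : Fin p → ℝ) : Type :=
  WithLp 2 (Lp (E n) 2 (boxMeasure T) × Lp (J p n) 2 (boxMeasure T))

/-- The Hilbert space `H¹_T = W^{1,2}_T`, as the space of pairs `(u, ∂u/∂t)`, where `u ∈ L²` and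
`∂u/∂t ∈ L²` is the weak derivative of `u`. The inner product is inherited from the pairs:
`⟨u, w⟩ = ∫ (u, w) + ∑_α ∫ (∂u/∂t^α, ∂w/∂t^α)`. -/
def H1T {p : ℕ} (n : ℕ) (T : Fin p → ℝ) : Submodule ℝ (PairSpace n T) where
  carrier := {x | HasWeakGradient T x.fst x.snd}
  zero_mem' := by
    intro f _ α
    have h1 : ∫ t in box T, (inner ℝ ((0 : Lp (E n) 2 (boxMeasure T)) t) (pderiv α f t) : ℝ) = 0 := by
      apply integral_eq_zero_of_ae
      filter_upwards [Lp.coeFn_zero (E n) 2 (boxMeasure T)] with t ht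
      rw [ht]
      simp
    have h2 : ∫ t in box T, (inner ℝ ((0 : Lp (J p n) 2 (boxMeasure T)) t α) (f t) : ℝ) = 0 := by
      apply integral_eq_zero_of_ae
      filter_upwards [Lp.coeFn_zero (J p n) 2 (boxMeasure T)] with t ht
      rw [ht]
      simp
    exact h1.trans (by rw [← neg_zero]; exact congrArg Neg.neg h2.symm)
  add_mem' := by
    intro x y hx hy f hf α
    have h1 : ∫ t in box T, (inner ℝ ((x + y).fst t) (pderiv α f t) : ℝ)
        = (∫ t in box T, inner ℝ (x.fst t) (pderiv α f t))
          + ∫ t in box T, inner ℝ (y.fst t) (pderiv α f t) := by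
      rw [← integral_add
        (integrable_inner_continuous T (Lp.memLp x.fst) (hf.continuous_pderiv α))
        (integrable_inner_continuous T (Lp.memLp y.fst) (hf.continuous_pderiv α))]
      apply integral_congr_ae
      filter_upwards [Lp.coeFn_add x.fst y.fst] with t ht
      rw [WithLp.add_fst, ht, Pi.add_apply, inner_add_left]
    have h2 : ∫ t in box T, (inner ℝ ((x + y).snd t α) (f t) : ℝ)
        = (∫ t in box T, inner ℝ (x.snd t α) (f t))
          + ∫ t in box T, inner ℝ (y.snd t α) (f t) := by
      rw [← integral_add
        (integrable_inner_continuous T (memLp_component x.snd α) hf.smooth.continuous)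
        (integrable_inner_continuous T (memLp_component y.snd α) hf.smooth.continuous)]
      apply integral_congr_ae
      filter_upwards [Lp.coeFn_add x.snd y.snd] with t ht
      rw [WithLp.add_snd, ht, Pi.add_apply, PiLp.add_apply, inner_add_left]
    rw [h1, h2, hx f hf α, hy f hf α, neg_add]
  smul_mem' := by
    intro c x hx f hf α
    have h1 : ∫ t in box T, (inner ℝ ((c • x).fst t) (pderiv α f t) : ℝ)
        = c * ∫ t in box T, inner ℝ (x.fst t) (pderiv α f t) := by
      rw [← integral_const_mul]
      apply integral_congr_ae
      filter_upwards [Lp.coeFn_smul c x.fst] with t ht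
      rw [WithLp.smul_fst, ht, Pi.smul_apply, real_inner_smul_left]
    have h2 : ∫ t in box T, (inner ℝ ((c • x).snd t α) (f t) : ℝ)
        = c * ∫ t in box T, inner ℝ (x.snd t α) (f t) := by
      rw [← integral_const_mul]
      apply integral_congr_ae
      filter_upwards [Lp.coeFn_smul c x.snd] with t ht
      rw [WithLp.smul_snd, ht, Pi.smul_apply, PiLp.smul_apply, real_inner_smul_left]
    rw [h1, h2, hx f hf α, mul_neg]

/-- The field `u` underlying an element of `H¹_T`. -/
def field {p n : ℕ} {T : Fin p → ℝ} (u : H1T n T) : (Fin p → ℝ) → E n := u.1.fst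

/-- The weak derivative `∂u/∂t` of an element of `H¹_T`. -/
def weakGrad {p n : ℕ} {T : Fin p → ℝ} (u : H1T n T) : (Fin p → ℝ) → J p n := u.1.snd

/-- `φ₁(u) = ∫_{T₀} F(t, u(t)) dt`. -/
def potentialAction {p n : ℕ} {T : Fin p → ℝ} (F : (Fin p → ℝ) → E n → ℝ) (u : H1T n T) : ℝ :=
  ∫ t in box T, F t (field u t)

/-- `φ(u) = ∫_{T₀} (½ |∂u/∂t|² + F(t, u(t))) dt`. -/
def action {p n : ℕ} {T : Fin p → ℝ} (F : (Fin p → ℝ) → E n → ℝ) (u : H1T n T) : ℝ :=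
  ∫ t in box T, ((1 / 2 : ℝ) * ‖weakGrad u t‖ ^ 2 + F t (field u t))

/-- Weak convergence of a sequence in a real normed space. -/
def WeaklyConverges {H : Type*} [NormedAddCommGroup H] [NormedSpace ℝ H] (x : ℕ → H) (u : H) :
    Prop :=
  ∀ l : H →L[ℝ] ℝ, Tendsto (fun k => l (x k)) atTop (𝓝 (l u))

/-- (Sequential) weak lower semicontinuity: `x k ⇀ u` implies `ψ u ≤ liminf ψ (x k)`. The lower
limit is taken in the extended reals, so that it always exists. -/
def WeaklyLSC {H : Type*} [NormedAddCommGroup H] [NormedSpace ℝ H] (ψ : H → ℝ) : Prop :=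
  ∀ (x : ℕ → H) (u : H), WeaklyConverges x u →
    (ψ u : EReal) ≤ liminf (fun k => (ψ (x k) : EReal)) atTop

/-- `w ∈ L²(T₀, ℝⁿ)` is the weak Laplacian of `u ∈ H¹_T`, i.e. the weak divergence of the Jacobi
matrix `∂u/∂t`, tested against `C_T^∞`. -/
def HasWeakLaplacian {p n : ℕ} {T : Fin p → ℝ} (u : H1T n T) (w : (Fin p → ℝ) → E n) : Prop :=
  MemLp w 2 (boxMeasure T) ∧
  ∀ f : (Fin p → ℝ) → E n, IsPeriodicTest T f →
    ∫ t in box T, ∑ α : Fin p, inner ℝ (weakGrad u t α) (pderiv α f t)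
      = - ∫ t in box T, inner ℝ (w t) (f t)

/-- `γ ∈ L²` is the trace of `f` on the face `{t ∈ T₀ | tⁱ = c}` (`c = 0` or `c = Tⁱ`). The face is
parametrized by the coordinates `t^j`, `j ≠ i`. The trace is characterized by
`h⁻¹ ∫_{t ∈ T₀, |tⁱ - c| ≤ h} |f(t) - γ((t^j)_{j ≠ i})| dt → 0` as `h ↓ 0`; it depends only on the
a.e. class of `f` and is unique up to null sets of the face. -/
def HasFaceTrace {p n : ℕ} (T : Fin p → ℝ) (i : Fin p) (c : ℝ) (f : (Fin p → ℝ) → E n)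
    (γ : ({j : Fin p // j ≠ i} → ℝ) → E n) : Prop :=
  MemLp γ 2 (volume.restrict (Set.Icc 0 (fun j : {j : Fin p // j ≠ i} => T j))) ∧
  Tendsto
    (fun h : ℝ =>
      (∫⁻ t in box T ∩ {t | |t i - c| ≤ h}, ‖f t - γ (fun j => t j)‖ₑ) / ENNReal.ofReal h)
    (𝓝[>] 0) (𝓝 0)

/-- The boundary conditions `f|_{S_i⁻} = f|_{S_i⁺}`, `i = 1, …, p`, where `S_i⁻ : tⁱ = 0` and
`S_i⁺ : tⁱ = Tⁱ`: the traces of `f` on opposite faces exist and coincide. -/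
def EqualOnOppositeFaces {p n : ℕ} (T : Fin p → ℝ) (f : (Fin p → ℝ) → E n) : Prop :=
  ∀ i : Fin p, ∃ γ : ({j : Fin p // j ≠ i} → ℝ) → E n,
    HasFaceTrace T i 0 f γ ∧ HasFaceTrace T i (T i) f γ

end PoissonGradient

end

/-! Existence is the direct method. The bound `g` is bounded on the compact box, so `F t` is
Lipschitz with a constant `L` uniform in `t`. Replacing `u` by its mean `m` in the potential
therefore costs at most `L ∫ |u - m|`, and Young's inequality with Poincaré–Wirtinger absorbs this
into `¼ ‖∂u/∂t‖²` and a constant: `φ(u) ≥ ¼ ‖∂u/∂t‖² + ∫ F(t, m) dt - K` (`exists_le_action`).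
Coercivity on constants then bounds the sublevel sets of `φ` in `H¹_T`. A minimizing sequence has a
weakly convergent subsequence; the kinetic part is convex, the potential part is weakly lower
semicontinuous by hypothesis, so the weak limit minimizes (`exists_isMinimizer`). The derivative of
`φ(u + s f)` at `s = 0` vanishes for each test function `f`, which is the weak equation
(`hasWeakLaplacian_of_isMinimizer`).

The boundary conditions rest on Fourier series. After rescaling, the box is the torus up to a null
set, and testing against characters turns the weak derivative in direction `α` into multiplication
of the coefficients by `i ω_α`, with `ω_α = 2π k_α / T^α`. This gives Poincaré–Wirtinger by
Parseval, and density of smooth periodic functions by truncation. Smooth periodic functions agree on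
opposite faces; a trace inequality carries this over to limits (`HasWeakGradient.exists_trace`), so
every function with an `L²` weak gradient has equal traces on opposite faces.

For the traces of `∂u/∂t^α` one more derivative is needed. The equation puts `Δu` in `L²`, and `|ω_α
ω_β| ≤ ∑ ω_γ²` bounds all second derivatives by the Laplacian on the Fourier side. Hence each
`∂u/∂t^α` has an `L²` weak gradient, and the same trace theorem applies to it. -/

noncomputable section

/-! ### The box as a torus: measure-preserving identification. -/

namespace PoissonGradient

open scoped ENNReal ComplexConjugate

variable {p : ℕ} {T : Fin p → ℝ}

/-- The normalised Haar measure on the torus `(ℝ/ℤ)ᵖ`. -/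
abbrev torusMeasure (p : ℕ) : Measure (UnitAddTorus (Fin p)) :=
  Measure.pi fun _ => AddCircle.haarAddCircle

/-- Lebesgue measure on the parallelepiped, normalised to total mass one. -/
def boxProb (T : Fin p → ℝ) : Measure (Fin p → ℝ) :=
  (∏ i, ENNReal.ofReal (T i)⁻¹) • boxMeasure T

/-- The quotient map `ℝᵖ → (ℝ/ℤ)ᵖ` which rescales the periods to one. -/
def toTorus (T : Fin p → ℝ) (t : Fin p → ℝ) : UnitAddTorus (Fin p) :=
  fun i => ((t i / T i : ℝ) : UnitAddCircle)

/-- The section of `toTorus` with values in `∏ (0, Tⁱ]`. -/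
def ofTorus (T : Fin p → ℝ) (x : UnitAddTorus (Fin p)) : Fin p → ℝ :=
  fun i => T i * (AddCircle.equivIoc 1 0 (x i)).1

theorem measurable_toTorus (T : Fin p → ℝ) : Measurable (toTorus T) :=
  measurable_pi_lambda _ fun i =>
    AddCircle.measurable_mk'.comp ((measurable_pi_apply i).div_const _)

theorem measurable_ofTorus (T : Fin p → ℝ) : Measurable (ofTorus T) :=
  measurable_pi_lambda _ fun i => (measurable_subtype_coe.comp
    ((AddCircle.measurableEquivIoc 1 0).measurable.comp (measurable_pi_apply i))).const_mul _

theorem toTorus_ofTorus (hT : ∀ i, 0 < T i) (x : UnitAddTorus (Fin p)) :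
    toTorus T (ofTorus T x) = x := by
  funext i
  have h : (AddCircle.equivIoc (1 : ℝ) 0).symm (AddCircle.equivIoc 1 0 (x i)) = x i :=
    Equiv.symm_apply_apply _ _
  simp only [toTorus, ofTorus]
  rw [mul_div_cancel_left₀ _ (hT i).ne']
  exact h

theorem ofTorus_toTorus (hT : ∀ i, 0 < T i) {t : Fin p → ℝ}
    (ht : ∀ i, t i ∈ Set.Ioc 0 (T i)) : ofTorus T (toTorus T t) = t := by
  funext i
  simp only [toTorus, ofTorus]
  rw [AddCircle.equivIoc_coe_eq (p := (1 : ℝ)) (a := 0) (x := t i / T i)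
    ⟨div_pos (ht i).1 (hT i), by rw [zero_add]; exact (div_le_one (hT i)).2 (ht i).2⟩]
  exact mul_div_cancel₀ _ (hT i).ne'

/-- Closed and half-open intervals differ by a null set; the half-open form matches the fundamental
domain `(0, 1]` of the circle. -/
theorem boxMeasure_eq_pi (T : Fin p → ℝ) :
    boxMeasure T = Measure.pi fun i => volume.restrict (Set.Ioc 0 (T i)) := by
  have h : boxMeasure T = Measure.pi fun i => volume.restrict (Set.Icc 0 (T i)) := by
    rw [← Measure.restrict_pi_pi, Set.pi_univ_Icc]
    rfl
  rw [h]
  congr 1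
  funext i
  exact (restrict_Ioc_eq_restrict_Icc).symm

theorem pi_smul_measure {ι : Type*} [Fintype ι] {α : ι → Type*} [∀ i, MeasurableSpace (α i)]
    (μ : ∀ i, Measure (α i)) [∀ i, IsFiniteMeasure (μ i)] (c : ι → ℝ≥0∞) (hc : ∀ i, c i ≠ ⊤) :
    Measure.pi (fun i => c i • μ i) = (∏ i, c i) • Measure.pi μ := by
  have : ∀ i, IsFiniteMeasure (c i • μ i) := fun i => Measure.smul_finite _ (hc i)
  refine Measure.pi_eq fun s _ => ?_
  simp [Measure.pi_pi, Finset.prod_mul_distrib]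

theorem boxProb_eq_pi (T : Fin p → ℝ) :
    boxProb T = Measure.pi fun i => ENNReal.ofReal (T i)⁻¹ • volume.restrict (Set.Ioc 0 (T i)) := by
  rw [pi_smul_measure _ _ fun i => ENNReal.ofReal_ne_top, ← boxMeasure_eq_pi]
  rfl

/-- Scaling by `c⁻¹` carries the normalised measure on `(0, c]` to Lebesgue measure on `(0, 1]`, on
which the quotient map to the circle preserves measure. -/
theorem measurePreserving_div_mk {c : ℝ} (hc : 0 < c) :
    MeasurePreserving (fun s : ℝ => ((s / c : ℝ) : UnitAddCircle))
      (ENNReal.ofReal c⁻¹ • volume.restrict (Set.Ioc 0 c)) AddCircle.haarAddCircle := by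
  have h1 : MeasurePreserving (fun s : ℝ => s / c)
      (ENNReal.ofReal c⁻¹ • volume.restrict (Set.Ioc 0 c)) (volume.restrict (Set.Ioc 0 (0 + 1))) := by
    have hm : Measurable fun s : ℝ => s / c := measurable_id.div_const c
    refine ⟨hm, ?_⟩
    have h2 : (fun s : ℝ => s / c) ⁻¹' Set.Ioc 0 (0 + 1) = Set.Ioc 0 c := by
      ext s
      simp [div_le_one hc, hc]
    rw [Measure.map_smul, ← h2, ← Measure.restrict_map hm measurableSet_Ioc]
    have h3 := Real.map_volume_mul_left (inv_ne_zero hc.ne')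
    rw [inv_inv, abs_of_pos hc] at h3
    simp only [div_eq_inv_mul]
    rw [h3, Measure.restrict_smul, smul_smul, ← ENNReal.ofReal_mul (inv_nonneg.2 hc.le),
      inv_mul_cancel₀ hc.ne', ENNReal.ofReal_one, one_smul]
  have h4 := AddCircle.measurePreserving_mk (1 : ℝ) 0
  rw [AddCircle.volume_eq_smul_haarAddCircle, ENNReal.ofReal_one, one_smul] at h4
  exact h4.comp h1

theorem measurePreserving_toTorus (hT : ∀ i, 0 < T i) :
    MeasurePreserving (toTorus T) (boxProb T) (torusMeasure p) := by
  have hs : ∀ i, SigmaFinite (ENNReal.ofReal (T i)⁻¹ • volume.restrict (Set.Ioc 0 (T i))) :=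
    fun i => by
      have : IsFiniteMeasure (ENNReal.ofReal (T i)⁻¹ • volume.restrict (Set.Ioc 0 (T i))) :=
        Measure.smul_finite _ ENNReal.ofReal_ne_top
      infer_instance
  rw [boxProb_eq_pi]
  exact measurePreserving_pi _ _ fun i => measurePreserving_div_mk (hT i)

theorem ae_boxProb_mem_Ioc (T : Fin p → ℝ) : ∀ᵐ t ∂boxProb T, ∀ i, t i ∈ Set.Ioc 0 (T i) := by
  refine Measure.ae_smul_measure ?_ _
  rw [boxMeasure_eq_pi, ← Measure.restrict_pi_pi]
  filter_upwards [ae_restrict_mem (MeasurableSet.univ_pi fun i => measurableSet_Ioc)] with t ht i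
  exact ht i trivial

/-- The section inverts `toTorus` off the null set where some coordinate is `0`, so pushing Haar
measure back recovers the measure it came from. -/
theorem measurePreserving_ofTorus (hT : ∀ i, 0 < T i) :
    MeasurePreserving (ofTorus T) (torusMeasure p) (boxProb T) := by
  refine ⟨measurable_ofTorus T, ?_⟩
  rw [← (measurePreserving_toTorus hT).map_eq, Measure.map_map (measurable_ofTorus T)
    (measurable_toTorus T)]
  conv_rhs => rw [← Measure.map_id (μ := boxProb T)]
  refine Measure.map_congr ?_
  filter_upwards [ae_boxProb_mem_Ioc T] with t ht
  exact ofTorus_toTorus hT ht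

theorem prod_ofReal_inv_ne_top (T : Fin p → ℝ) : (∏ i, ENNReal.ofReal (T i)⁻¹) ≠ ⊤ :=
  ENNReal.prod_ne_top fun _ _ => ENNReal.ofReal_ne_top

theorem prod_ofReal_inv_ne_zero (hT : ∀ i, 0 < T i) : (∏ i, ENNReal.ofReal (T i)⁻¹) ≠ 0 :=
  Finset.prod_ne_zero_iff.2 fun i _ => by simpa using hT i

theorem integral_boxProb {V : Type*} [NormedAddCommGroup V] [NormedSpace ℝ V]
    (h : (Fin p → ℝ) → V) :
    ∫ t, h t ∂boxProb T = (∏ i, ENNReal.ofReal (T i)⁻¹).toReal • ∫ t in box T, h t :=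
  integral_smul_measure _ _

theorem integral_boxProb_comp {V : Type*} [NormedAddCommGroup V] [NormedSpace ℝ V]
    (hT : ∀ i, 0 < T i) {h : (Fin p → ℝ) → V} (hh : AEStronglyMeasurable h (boxProb T)) :
    ∫ x, h (ofTorus T x) ∂torusMeasure p = ∫ t, h t ∂boxProb T := by
  have := measurePreserving_ofTorus hT
  rw [← this.map_eq] at hh ⊢
  exact (integral_map (measurable_ofTorus T).aemeasurable hh).symm

theorem memLp_boxProb {V : Type*} [NormedAddCommGroup V] {q : ℝ≥0∞}
    {h : (Fin p → ℝ) → V} (hh : MemLp h q (boxMeasure T)) : MemLp h q (boxProb T) :=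
  hh.smul_measure (prod_ofReal_inv_ne_top T)

theorem boxMeasure_eq_smul (hT : ∀ i, 0 < T i) :
    boxMeasure T = (∏ i, ENNReal.ofReal (T i)⁻¹)⁻¹ • boxProb T := by
  have h := ENNReal.inv_mul_cancel (prod_ofReal_inv_ne_zero hT) (prod_ofReal_inv_ne_top T)
  rw [boxProb, smul_smul, h, one_smul]

theorem memLp_boxMeasure {V : Type*} [NormedAddCommGroup V] {q : ℝ≥0∞} (hT : ∀ i, 0 < T i)
    {h : (Fin p → ℝ) → V} (hh : MemLp h q (boxProb T)) : MemLp h q (boxMeasure T) := by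
  rw [boxMeasure_eq_smul hT]
  exact hh.smul_measure (ENNReal.inv_ne_top.2 (prod_ofReal_inv_ne_zero hT))

end PoissonGradient

end

/-! ### Fourier series of square integrable functions on the box. -/

noncomputable section

namespace PoissonGradient

open scoped ENNReal ComplexConjugate

variable {p : ℕ} {T : Fin p → ℝ}

/-- The Fourier basis of `L²` of the torus. -/
def torusBasis (p : ℕ) : HilbertBasis (Fin p → ℤ) ℂ (Lp ℂ 2 (torusMeasure p)) :=
  UnitAddTorus.mFourierBasis

theorem coe_torusBasis (k : Fin p → ℤ) :
    (torusBasis p k : UnitAddTorus (Fin p) → ℂ) =ᵐ[torusMeasure p] UnitAddTorus.mFourier k := by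
  have h : torusBasis p k = UnitAddTorus.mFourierLp 2 k :=
    congrFun UnitAddTorus.coe_mFourierBasis k
  rw [h]
  exact UnitAddTorus.coeFn_mFourierLp 2 k

/-- The exponential monomial `exp (2πi ∑ kⱼ tʲ / Tʲ)`. -/
def expMonomial (T : Fin p → ℝ) (k : Fin p → ℤ) (t : Fin p → ℝ) : ℂ :=
  UnitAddTorus.mFourier k (toTorus T t)

/-- The Fourier coefficients of a function on the parallelepiped. -/
def boxCoeff (T : Fin p → ℝ) (h : (Fin p → ℝ) → ℂ) (k : Fin p → ℤ) : ℂ :=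
  ∫ t, conj (expMonomial T k t) * h t ∂boxProb T

theorem measurable_expMonomial (T : Fin p → ℝ) (k : Fin p → ℤ) : Measurable (expMonomial T k) :=
  (UnitAddTorus.mFourier k).continuous.measurable.comp (measurable_toTorus T)

/-- A square integrable function on the parallelepiped, seen on the torus. -/
def torusLp (hT : ∀ i, 0 < T i) (h : (Fin p → ℝ) → ℂ) (hh : MemLp h 2 (boxProb T)) :
    Lp ℂ 2 (torusMeasure p) :=
  (hh.comp_measurePreserving (measurePreserving_ofTorus hT)).toLp (h ∘ ofTorus T)

theorem coe_torusLp (hT : ∀ i, 0 < T i) {h : (Fin p → ℝ) → ℂ} (hh : MemLp h 2 (boxProb T)) :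
    torusLp hT h hh =ᵐ[torusMeasure p] h ∘ ofTorus T :=
  MemLp.coeFn_toLp _

/-- A basis coefficient is the inner product with a character, an integral over the torus that the
measure-preserving section turns into one over the box. -/
theorem torusBasis_repr (hT : ∀ i, 0 < T i) {h : (Fin p → ℝ) → ℂ} (hh : MemLp h 2 (boxProb T))
    (k : Fin p → ℤ) : (torusBasis p).repr (torusLp hT h hh) k = boxCoeff T h k := by
  rw [HilbertBasis.repr_apply_apply, L2.inner_def, boxCoeff, ← integral_boxProb_comp hT]
  · refine integral_congr_ae ?_
    filter_upwards [coe_torusBasis k, coe_torusLp hT hh] with x h1 h2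
    rw [h1, h2, expMonomial, toTorus_ofTorus hT, RCLike.inner_apply, mul_comm]
    rfl
  · exact (Complex.continuous_conj.comp_aestronglyMeasurable
      (measurable_expMonomial T k).aestronglyMeasurable).mul hh.1

/-- **Parseval's identity**. -/
theorem hasSum_boxCoeff (hT : ∀ i, 0 < T i) {h h' : (Fin p → ℝ) → ℂ}
    (hh : MemLp h 2 (boxProb T)) (hh' : MemLp h' 2 (boxProb T)) :
    HasSum (fun k => conj (boxCoeff T h k) * boxCoeff T h' k)
      (∫ t, conj (h t) * h' t ∂boxProb T) := by
  have key := (torusBasis p).hasSum_inner_mul_inner (torusLp hT h hh) (torusLp hT h' hh')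
  have e : (inner ℂ (torusLp hT h hh) (torusLp hT h' hh') : ℂ)
      = ∫ t, conj (h t) * h' t ∂boxProb T := by
    have hm : AEStronglyMeasurable (fun t => conj (h t) * h' t) (boxProb T) :=
      (Complex.continuous_conj.comp_aestronglyMeasurable hh.1).mul hh'.1
    rw [L2.inner_def, ← integral_boxProb_comp hT hm]
    refine integral_congr_ae ?_
    filter_upwards [coe_torusLp hT hh, coe_torusLp hT hh'] with x h1 h2
    rw [h1, h2, RCLike.inner_apply, mul_comm]
    rfl
  rw [e] at key
  refine key.congr_fun fun k => ?_
  rw [← torusBasis_repr hT hh, ← torusBasis_repr hT hh', HilbertBasis.repr_apply_apply,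
    HilbertBasis.repr_apply_apply, inner_conj_symm]

theorem hasSum_norm_sq_boxCoeff (hT : ∀ i, 0 < T i) {h : (Fin p → ℝ) → ℂ}
    (hh : MemLp h 2 (boxProb T)) :
    HasSum (fun k => ‖boxCoeff T h k‖ ^ 2) (∫ t, ‖h t‖ ^ 2 ∂boxProb T) := by
  have key := hasSum_boxCoeff hT hh hh
  simp only [RCLike.conj_mul] at key
  have e : ∀ z : ℂ, ((‖z‖ : ℂ)) ^ 2 = ((‖z‖ ^ 2 : ℝ) : ℂ) := fun z => by push_cast; rfl
  simp only [RCLike.ofReal_eq_complex_ofReal, e] at key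
  rw [integral_complex_ofReal] at key
  exact Complex.hasSum_ofReal.1 key

/-- **Riesz–Fischer**. -/
theorem exists_boxCoeff_eq (hT : ∀ i, 0 < T i) {c : (Fin p → ℤ) → ℂ}
    (hc : Summable fun k => ‖c k‖ ^ 2) :
    ∃ h : (Fin p → ℝ) → ℂ, MemLp h 2 (boxProb T) ∧ ∀ k, boxCoeff T h k = c k := by
  have hc2 : Memℓp c 2 := memℓp_gen (by simpa using hc)
  set G := (torusBasis p).repr.symm ⟨c, hc2⟩ with hG
  have hm := (Lp.memLp G).comp_measurePreserving (measurePreserving_toTorus hT)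
  refine ⟨G ∘ toTorus T, hm, fun k => ?_⟩
  have e : torusLp hT _ hm = G := by
    refine Lp.ext ((coe_torusLp hT hm).trans (Eventually.of_forall fun x => ?_))
    simp [toTorus_ofTorus hT]
  rw [← torusBasis_repr hT hm, e, hG, LinearIsometryEquiv.apply_symm_apply]

/-- The Fourier series of a square integrable function converges to it in `L²`. -/
theorem tendsto_eLpNorm_fourier (hT : ∀ i, 0 < T i) {h : (Fin p → ℝ) → ℂ}
    (hh : MemLp h 2 (boxProb T)) :
    Tendsto (fun S : Finset (Fin p → ℤ) =>
      eLpNorm (fun t => (∑ k ∈ S, boxCoeff T h k * expMonomial T k t) - h t) 2 (boxProb T))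
      atTop (𝓝 0) := by
  have key := (torusBasis p).hasSum_repr (torusLp hT h hh)
  rw [HasSum, SummationFilter.unconditional_filter, Lp.tendsto_Lp_iff_tendsto_eLpNorm'] at key
  refine key.congr fun S => ?_
  have hm : AEStronglyMeasurable
      (fun t => (∑ k ∈ S, boxCoeff T h k * expMonomial T k t) - h t) (boxProb T) :=
    ((Finset.measurable_fun_sum S fun k _ =>
      (measurable_expMonomial T k).const_mul _).aestronglyMeasurable).sub hh.1
  rw [← eLpNorm_comp_measurePreserving hm (measurePreserving_ofTorus hT)]
  refine eLpNorm_congr_ae ?_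
  -- The exceptional null set depends on `k`; only finitely many `k` occur.
  have h3 : ∀ᵐ x ∂torusMeasure p, ∀ k ∈ S,
      (torusBasis p k : UnitAddTorus (Fin p) → ℂ) x = UnitAddTorus.mFourier k x :=
    (ae_ball_iff S.countable_toSet).2 fun k _ => coe_torusBasis k
  have h4 : ∀ᵐ x ∂torusMeasure p, ∀ k ∈ S,
      (((torusBasis p).repr (torusLp hT h hh) k • torusBasis p k : Lp ℂ 2 (torusMeasure p)) :
        UnitAddTorus (Fin p) → ℂ) x
      = (torusBasis p).repr (torusLp hT h hh) k • (torusBasis p k : UnitAddTorus (Fin p) → ℂ) x :=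
    (ae_ball_iff S.countable_toSet).2 fun k _ => Lp.coeFn_smul _ _
  filter_upwards [coe_torusLp hT hh, h3, h4,
    Lp.coeFn_finsetSum S fun k => (torusBasis p).repr (torusLp hT h hh) k • torusBasis p k] with x h1 h3 h4 h5
  simp only [Pi.sub_apply, Function.comp_apply, h5, h1, Finset.sum_apply]
  congr 1
  refine Finset.sum_congr rfl fun k hk => ?_
  rw [h4 k hk, h3 k hk, torusBasis_repr hT hh, expMonomial, toTorus_ofTorus hT, smul_eq_mul]

end PoissonGradient

end

/-! ### Slicing the box along one axis, and calculus on the slices. -/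

noncomputable section

namespace PoissonGradient

open scoped ENNReal ComplexConjugate

variable {p : ℕ} {T : Fin p → ℝ}

/-- The point with `i`-th coordinate `s` and the other coordinates given by `t'`. -/
def glue (i : Fin p) (t' : {j : Fin p // j ≠ i} → ℝ) (s : ℝ) : Fin p → ℝ :=
  fun j => if h : j = i then s else t' ⟨j, h⟩

@[simp]
theorem glue_same (i : Fin p) (t' : {j : Fin p // j ≠ i} → ℝ) (s : ℝ) : glue i t' s i = s := by
  simp [glue]

@[simp]
theorem glue_coe (i : Fin p) (t' : {j : Fin p // j ≠ i} → ℝ) (s : ℝ) (j : {j : Fin p // j ≠ i}) :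
    glue i t' s j = t' j := by
  simp [glue, j.2]

theorem glue_restrict (i : Fin p) (t : Fin p → ℝ) :
    glue i (fun j : {j : Fin p // j ≠ i} => t j) (t i) = t := by
  funext j
  by_cases h : j = i
  · subst h; simp
  · exact glue_coe i _ _ ⟨j, h⟩

theorem glue_eq_add (i : Fin p) (t' : {j : Fin p // j ≠ i} → ℝ) (s : ℝ) :
    glue i t' s = glue i t' 0 + Pi.single i s := by
  funext j
  by_cases h : j = i
  · subst h; simp
  · simp [glue, h]

theorem continuous_glue (i : Fin p) :
    Continuous fun z : ({j : Fin p // j ≠ i} → ℝ) × ℝ => glue i z.1 z.2 := by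
  refine continuous_pi fun j => ?_
  by_cases h : j = i
  · simpa [glue, h] using continuous_snd
  · simp only [glue, h, dite_false]
    exact (continuous_apply (⟨j, h⟩ : {j : Fin p // j ≠ i})).comp continuous_fst

/-- Splitting off the `i`-th coordinate. -/
def glueEquiv (i : Fin p) : (({j : Fin p // j ≠ i} → ℝ) × ℝ) ≃ᵐ (Fin p → ℝ) where
  toFun z := glue i z.1 z.2
  invFun t := (fun j => t j, t i)
  left_inv z := by ext <;> simp
  right_inv t := glue_restrict i t
  measurable_toFun := (continuous_glue i).measurable
  measurable_invFun := (measurable_pi_lambda _ fun j => measurable_pi_apply _).prodMk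
    (measurable_pi_apply i)

@[simp]
theorem glueEquiv_apply (i : Fin p) (z : ({j : Fin p // j ≠ i} → ℝ) × ℝ) :
    glueEquiv i z = glue i z.1 z.2 := rfl

theorem glueEquiv_preimage_pi (i : Fin p) (s : Fin p → Set ℝ) :
    glueEquiv i ⁻¹' Set.pi Set.univ s
      = (Set.pi Set.univ fun j : {j : Fin p // j ≠ i} => s j) ×ˢ s i := by
  ext z
  simp only [Set.mem_preimage, Set.mem_pi, Set.mem_univ, true_implies, Set.mem_prod, glueEquiv_apply]
  constructor
  · exact fun h => ⟨fun j => by simpa using h j, by simpa using h i⟩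
  · rintro ⟨h1, h2⟩ j
    by_cases h : j = i
    · subst h; simpa using h2
    · simpa [glue, h] using h1 ⟨j, h⟩

theorem measurePreserving_glueEquiv (i : Fin p) :
    MeasurePreserving (glueEquiv i) (volume.prod volume) volume := by
  refine ⟨(glueEquiv i).measurable, (Measure.pi_eq fun s _ => ?_).symm⟩
  rw [(glueEquiv i).map_apply, glueEquiv_preimage_pi, Measure.prod_prod, volume_pi_pi]
  exact (mul_comm _ _).trans (Fintype.prod_eq_mul_prod_subtype_ne (fun j => volume (s j)) i).symm

/-- The face of the parallelepiped orthogonal to the `i`-th axis. -/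
abbrev face (T : Fin p → ℝ) (i : Fin p) : Set ({j : Fin p // j ≠ i} → ℝ) :=
  Set.Icc 0 fun j : {j : Fin p // j ≠ i} => T j

theorem glueEquiv_preimage_slab (T : Fin p → ℝ) (i : Fin p) (A : Set ℝ) :
    glueEquiv i ⁻¹' (box T ∩ {t | t i ∈ A}) = face T i ×ˢ (Set.Icc 0 (T i) ∩ A) := by
  have h : box T = Set.pi Set.univ fun j => Set.Icc 0 (T j) := (Set.pi_univ_Icc 0 T).symm
  have h' : face T i = Set.pi Set.univ fun j : {j : Fin p // j ≠ i} => Set.Icc 0 (T j) :=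
    (Set.pi_univ_Icc _ _).symm
  rw [Set.preimage_inter, h, glueEquiv_preimage_pi, h']
  ext z
  have h1 : z ∈ glueEquiv i ⁻¹' {t | t i ∈ A} ↔ z.2 ∈ A := by
    simp only [Set.mem_preimage, Set.mem_ofPred_eq, glueEquiv_apply, glue_same]
  rw [Set.mem_inter_iff, h1, Set.mem_prod, Set.mem_prod, Set.mem_inter_iff, and_assoc]

theorem measurePreserving_glueEquiv_slab (T : Fin p → ℝ) (i : Fin p) (A : Set ℝ) :
    MeasurePreserving (glueEquiv i)
      ((volume.restrict (face T i)).prod (volume.restrict (Set.Icc 0 (T i) ∩ A)))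
      (volume.restrict (box T ∩ {t | t i ∈ A})) := by
  rw [Measure.prod_restrict, ← glueEquiv_preimage_slab]
  exact (measurePreserving_glueEquiv i).restrict_preimage_emb (glueEquiv i).measurableEmbedding _

/-- Tonelli for the splitting of the `i`-th coordinate. -/
theorem lintegral_slab (T : Fin p → ℝ) (i : Fin p) (A : Set ℝ) {f : (Fin p → ℝ) → ℝ≥0∞}
    (hf : Measurable f) :
    ∫⁻ t in box T ∩ {t | t i ∈ A}, f t
      = ∫⁻ t' in face T i, ∫⁻ s in Set.Icc 0 (T i) ∩ A, f (glue i t' s) := by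
  rw [← (measurePreserving_glueEquiv_slab T i A).lintegral_comp hf, lintegral_prod]
  · rfl
  · exact (hf.comp (glueEquiv i).measurable).aemeasurable

theorem isFiniteMeasure_boxMeasure (T : Fin p → ℝ) : IsFiniteMeasure (boxMeasure T) :=
  ⟨by simpa [boxMeasure, box] using
    (isCompact_Icc (a := (0 : Fin p → ℝ)) (b := T)).measure_lt_top⟩

section Calculus

variable {V : Type*} [NormedAddCommGroup V] [NormedSpace ℝ V]

theorem hasDerivAt_glue {G : (Fin p → ℝ) → V} (hG : ContDiff ℝ 1 G) (i : Fin p)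
    (t' : {j : Fin p // j ≠ i} → ℝ) (s : ℝ) :
    HasDerivAt (fun s => G (glue i t' s)) (fderiv ℝ G (glue i t' s) (Pi.single i 1)) s := by
  have h1 : HasDerivAt (glue i t') (Pi.single i (1 : ℝ)) s := by
    have h2 : glue i t' = fun s => glue i t' 0 + s • (Pi.single i (1 : ℝ) : Fin p → ℝ) := by
      funext s
      rw [glue_eq_add, ← Pi.single_smul, smul_eq_mul, mul_one]
    rw [h2]
    simpa using ((hasDerivAt_id s).smul_const (Pi.single i (1 : ℝ) : Fin p → ℝ)).const_add
      (glue i t' 0)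
  exact ((hG.differentiable one_ne_zero).differentiableAt.hasFDerivAt).comp_hasDerivAt s h1

theorem continuous_fderiv_single {G : (Fin p → ℝ) → V} (hG : ContDiff ℝ 1 G) (i : Fin p) :
    Continuous fun t => fderiv ℝ G t (Pi.single i 1) :=
  (hG.continuous_fderiv one_ne_zero).clm_apply continuous_const

theorem continuous_glue_right (i : Fin p) (t' : {j : Fin p // j ≠ i} → ℝ) :
    Continuous (glue i t') :=
  (continuous_glue i).comp (Continuous.prodMk_right t')

variable [CompleteSpace V]

theorem integral_fderiv_glue {G : (Fin p → ℝ) → V} (hG : ContDiff ℝ 1 G) (i : Fin p)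
    (t' : {j : Fin p // j ≠ i} → ℝ) (a b : ℝ) :
    ∫ s in a..b, fderiv ℝ G (glue i t' s) (Pi.single i 1) = G (glue i t' b) - G (glue i t' a) :=
  intervalIntegral.integral_eq_sub_of_hasDerivAt (fun s _ => hasDerivAt_glue hG i t' s)
    (((continuous_fderiv_single hG i).comp (continuous_glue_right i t')).intervalIntegrable _ _)

/-- The integral of a partial derivative of a periodic function over a period box vanishes. -/
theorem setIntegral_fderiv_eq_zero (hT : ∀ i, 0 < T i) {G : (Fin p → ℝ) → V}
    (hG : ContDiff ℝ 1 G) (i : Fin p) (hper : ∀ t, G (t + Pi.single i (T i)) = G t) :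
    ∫ t in box T, fderiv ℝ G t (Pi.single i 1) = 0 := by
  have hb : box T = box T ∩ {t | t i ∈ Set.univ} := by simp
  have hmp := measurePreserving_glueEquiv_slab T i Set.univ
  rw [← hb] at hmp
  have hint : Integrable (fun t => fderiv ℝ G t (Pi.single i 1)) (boxMeasure T) :=
    (continuous_fderiv_single hG i).continuousOn.integrableOn_compact isCompact_Icc
  rw [← hmp.integral_comp (glueEquiv i).measurableEmbedding, integral_prod]
  -- On each line parallel to the axis the integral is a difference of endpoint values, which
  -- periodicity makes equal.
  · refine integral_eq_zero_of_ae (Eventually.of_forall fun t' => ?_)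
    have h := integral_fderiv_glue hG i t' 0 (T i)
    rw [glue_eq_add i t' (T i), hper, sub_self, intervalIntegral.integral_of_le (hT i).le,
      ← integral_Icc_eq_integral_Ioc] at h
    simpa using h
  · exact (hmp.integrable_comp_emb (glueEquiv i).measurableEmbedding).2 hint

/-- Fundamental theorem of calculus on the segment from `c` to `s`, enlarged to all of `I` so that
the bound no longer depends on `s`. -/
theorem enorm_sub_glue_le {G : (Fin p → ℝ) → V} (hG : ContDiff ℝ 1 G) (i : Fin p)
    (t' : {j : Fin p // j ≠ i} → ℝ) {I : Set ℝ} (hI : I.OrdConnected) {s c : ℝ} (hs : s ∈ I)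
    (hc : c ∈ I) :
    ‖G (glue i t' s) - G (glue i t' c)‖ₑ
      ≤ ∫⁻ r in I, ‖fderiv ℝ G (glue i t' r) (Pi.single i 1)‖ₑ := by
  rw [← integral_fderiv_glue hG i t' c s, ← ofReal_norm,
    intervalIntegral.norm_integral_eq_norm_integral_uIoc, ofReal_norm]
  refine (enorm_integral_le_lintegral_enorm _).trans (lintegral_mono_set ?_)
  exact Set.uIoc_subset_uIcc.trans (hI.uIcc_subset hc hs)

/-- Since `c` is an endpoint, only one side of it lies in the interval: the length is at most `h`
rather than `2h`. -/
theorem volume_Icc_inter_le {a c h : ℝ} (hc : c = 0 ∨ c = a) :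
    volume (Set.Icc 0 a ∩ {s | |s - c| ≤ h}) ≤ ENNReal.ofReal h := by
  have : Set.Icc 0 a ∩ {s | |s - c| ≤ h} ⊆ Set.Icc 0 h ∨
      Set.Icc 0 a ∩ {s | |s - c| ≤ h} ⊆ Set.Icc (a - h) a := by
    rcases hc with rfl | rfl
    · refine Or.inl fun s hs => ⟨hs.1.1, ?_⟩
      have := (abs_le.1 (show |s - 0| ≤ h from hs.2)).2
      linarith
    · refine Or.inr fun s hs => ⟨?_, hs.1.2⟩
      have := (abs_le.1 (show |s - c| ≤ h from hs.2)).1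
      linarith
  rcases this with h1 | h1
  · exact (measure_mono h1).trans (by simp)
  · exact (measure_mono h1).trans (by simp)

/-- Near a face, the deviation of a smooth function from its values on the face is controlled by
its normal derivative. -/
theorem lintegral_slab_sub_le (hT : ∀ i, 0 < T i) {G : (Fin p → ℝ) → V} (hG : ContDiff ℝ 1 G)
    (i : Fin p) {c h : ℝ} (hc : c = 0 ∨ c = T i) (hh : 0 ≤ h) :
    ∫⁻ t in box T ∩ {t | |t i - c| ≤ h}, ‖G t - G (glue i (fun j => t j) c)‖ₑ
      ≤ ENNReal.ofReal h
        * ∫⁻ t in box T ∩ {t | |t i - c| ≤ h}, ‖fderiv ℝ G t (Pi.single i 1)‖ₑ := by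
  set A : Set ℝ := {s | |s - c| ≤ h} with hA
  have hI : (Set.Icc 0 (T i) ∩ A).OrdConnected := by
    refine Set.OrdConnected.inter Set.ordConnected_Icc ?_
    have : A = Set.Icc (c - h) (c + h) := by
      ext s
      rw [hA, Set.mem_ofPred_eq, Set.mem_Icc, abs_le]
      constructor <;> rintro ⟨h1, h2⟩ <;> constructor <;> linarith
    rw [this]
    exact Set.ordConnected_Icc
  have hcI : c ∈ Set.Icc 0 (T i) ∩ A := by
    refine ⟨?_, by simpa [hA] using hh⟩
    rcases hc with rfl | rfl
    · exact ⟨le_rfl, (hT i).le⟩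
    · exact ⟨(hT i).le, le_rfl⟩
  have hm1 : Measurable fun t : Fin p → ℝ =>
      ‖G t - G (glue i (fun j : {j : Fin p // j ≠ i} => t j) c)‖ₑ := by
    refine Continuous.measurable (hG.continuous.sub (hG.continuous.comp ?_)).enorm
    have h1 : Continuous fun t : Fin p → ℝ => (fun j : {j : Fin p // j ≠ i} => t j) :=
      continuous_pi fun j => continuous_apply (j : Fin p)
    exact (continuous_glue i).comp (h1.prodMk continuous_const)
  have hm2 : Measurable fun t => ‖fderiv ℝ G t (Pi.single i 1)‖ₑ :=
    (continuous_fderiv_single hG i).enorm.measurable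
  have hm3 : Measurable fun t' => ∫⁻ r in Set.Icc 0 (T i) ∩ A,
      ‖fderiv ℝ G (glue i t' r) (Pi.single i 1)‖ₑ :=
    (hm2.comp (continuous_glue i).measurable).lintegral_prod_right'
  change ∫⁻ t in box T ∩ {t | t i ∈ A}, _ ≤ _ * ∫⁻ t in box T ∩ {t | t i ∈ A}, _
  rw [lintegral_slab T i A hm1, lintegral_slab T i A hm2, ← lintegral_const_mul _ hm3]
  refine lintegral_mono fun t' => ?_
  simp only [glue_coe]
  -- The pointwise bound is constant in `s`, so integrating it costs only the thickness of the slab.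
  refine (setLIntegral_mono' (measurableSet_Icc.inter ?_)
    fun s hs => enorm_sub_glue_le hG i t' hI hs hcI).trans ?_
  · exact measurableSet_le (by fun_prop) measurable_const
  · rw [setLIntegral_const, mul_comm]
    gcongr
    exact volume_Icc_inter_le hc

end Calculus

end PoissonGradient

end

/-! ### Weak derivatives in terms of Fourier coefficients. -/

noncomputable section

namespace PoissonGradient

open scoped ENNReal ComplexConjugate

variable {p n : ℕ} {T : Fin p → ℝ}

/-- The frequency `2π k_α / T^α`. -/
def freq (T : Fin p → ℝ) (α : Fin p) (k : Fin p → ℤ) : ℝ := 2 * Real.pi * k α / T α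

theorem expMonomial_eq (T : Fin p → ℝ) (k : Fin p → ℤ) (t : Fin p → ℝ) :
    expMonomial T k t = Complex.exp (Complex.I * ((∑ j, freq T j k * t j : ℝ) : ℂ)) := by
  simp only [expMonomial, UnitAddTorus.mFourier, ContinuousMap.coe_mk, toTorus]
  push_cast
  rw [Finset.mul_sum, Complex.exp_sum]
  refine Finset.prod_congr rfl fun j _ => ?_
  rw [fourier_coe_apply]
  congr 1
  simp only [freq]
  push_cast
  ring

/-- Smooth complex-valued functions with the periods `T`. -/
structure IsPeriodicSmooth (T : Fin p → ℝ) (φ : (Fin p → ℝ) → ℂ) : Prop where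
  smooth : ContDiff ℝ ∞ φ
  periodic : ∀ (i : Fin p) (t : Fin p → ℝ), φ (t + Pi.single i (T i)) = φ t

theorem hasFDerivAt_phase (T : Fin p → ℝ) (k : Fin p → ℤ) (t : Fin p → ℝ) :
    HasFDerivAt (fun t : Fin p → ℝ => ∑ j, freq T j k * t j)
      (∑ j, freq T j k • (ContinuousLinearMap.proj j : (Fin p → ℝ) →L[ℝ] ℝ)) t := by
  have h := (∑ j, freq T j k • (ContinuousLinearMap.proj j : (Fin p → ℝ) →L[ℝ] ℝ)).hasFDerivAt (x := t)
  refine h.congr_of_eventuallyEq (Eventually.of_forall fun s => ?_)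
  simp

theorem isPeriodicSmooth_expMonomial (hT : ∀ i, 0 < T i) (k : Fin p → ℤ) :
    IsPeriodicSmooth T (expMonomial T k) := by
  refine ⟨?_, fun i t => ?_⟩
  · have h : expMonomial T k = fun t => Complex.exp (Complex.I * ((∑ j, freq T j k * t j : ℝ) : ℂ)) :=
      funext (expMonomial_eq T k)
    rw [h]
    have h1 : ContDiff ℝ ∞ fun t : Fin p → ℝ => ∑ j, freq T j k * t j :=
      ContDiff.sum fun j _ => contDiff_const.mul (ContinuousLinearMap.proj j : (Fin p → ℝ) →L[ℝ] ℝ).contDiff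
    exact (contDiff_const.mul (Complex.ofRealCLM.contDiff.comp h1)).cexp
  · simp only [expMonomial]
    congr 1
    funext j
    simp only [toTorus, Pi.add_apply]
    by_cases h : j = i
    · subst h
      rw [Pi.single_eq_same, add_div, div_self (hT j).ne']
      exact AddCircle.coe_add_period 1 _
    · rw [Pi.single_eq_of_ne h, add_zero]

theorem fderiv_expMonomial (T : Fin p → ℝ) (k : Fin p → ℤ) (t : Fin p → ℝ) (α : Fin p) :
    fderiv ℝ (expMonomial T k) t (Pi.single α 1)
      = Complex.I * freq T α k * expMonomial T k t := by
  have h : expMonomial T k = fun t => Complex.exp (Complex.I * ((∑ j, freq T j k * t j : ℝ) : ℂ)) :=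
    funext (expMonomial_eq T k)
  have h1 : HasFDerivAt (fun t : Fin p → ℝ => ((∑ j, freq T j k * t j : ℝ) : ℂ))
      (Complex.ofRealCLM.comp
        (∑ j, freq T j k • (ContinuousLinearMap.proj j : (Fin p → ℝ) →L[ℝ] ℝ))) t :=
    Complex.ofRealCLM.hasFDerivAt.comp t (hasFDerivAt_phase T k t)
  have h2 := (h1.const_mul Complex.I).cexp
  rw [← h] at h2
  rw [h2.fderiv, expMonomial_eq]
  simp [Pi.single_apply]
  ring

theorem conj_expMonomial (T : Fin p → ℝ) (k : Fin p → ℤ) (t : Fin p → ℝ) :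
    conj (expMonomial T k t) = expMonomial T (-k) t :=
  UnitAddTorus.mFourier_neg.symm

theorem freq_neg (T : Fin p → ℝ) (α : Fin p) (k : Fin p → ℤ) : freq T α (-k) = -freq T α k := by
  simp only [freq, Pi.neg_apply]
  push_cast
  ring

theorem memLp_of_continuous {V : Type*} [NormedAddCommGroup V] [SecondCountableTopology V]
    {f : (Fin p → ℝ) → V} (hf : Continuous f) (q : ℝ≥0∞) : MemLp f q (boxMeasure T) := by
  have := isFiniteMeasure_boxMeasure T
  obtain ⟨C, hC⟩ := (isCompact_Icc (a := (0 : Fin p → ℝ)) (b := T)).exists_bound_of_continuousOn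
    hf.continuousOn
  exact MemLp.of_bound hf.aestronglyMeasurable C
      ((ae_restrict_iff' measurableSet_Icc).2 (Eventually.of_forall hC))

namespace IsPeriodicSmooth

variable {φ ψ : (Fin p → ℝ) → ℂ}

theorem continuous (hφ : IsPeriodicSmooth T φ) : Continuous φ := hφ.smooth.continuous

theorem differentiable (hφ : IsPeriodicSmooth T φ) : Differentiable ℝ φ :=
  hφ.smooth.differentiable (by simp)

theorem continuous_fderiv (hφ : IsPeriodicSmooth T φ) (α : Fin p) :
    Continuous fun t => fderiv ℝ φ t (Pi.single α 1) :=
  (hφ.smooth.continuous_fderiv (by simp)).clm_apply continuous_const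

theorem mul (hφ : IsPeriodicSmooth T φ) (hψ : IsPeriodicSmooth T ψ) :
    IsPeriodicSmooth T fun t => φ t * ψ t :=
  ⟨hφ.smooth.mul hψ.smooth, fun i t => by rw [hφ.periodic, hψ.periodic]⟩

theorem star (hφ : IsPeriodicSmooth T φ) : IsPeriodicSmooth T fun t => conj (φ t) :=
  ⟨Complex.conjCLE.contDiff.comp hφ.smooth, fun i t => by rw [hφ.periodic]⟩

theorem fderiv_star (hφ : IsPeriodicSmooth T φ) (t : Fin p → ℝ) (α : Fin p) :
    fderiv ℝ (fun t => conj (φ t)) t (Pi.single α 1) = conj (fderiv ℝ φ t (Pi.single α 1)) := by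
  have h : HasFDerivAt (fun t => conj (φ t)) _ t :=
    Complex.conjCLE.hasFDerivAt.comp t (hφ.differentiable t).hasFDerivAt
  rw [h.fderiv]
  rfl

/-- The Fourier coefficients of a partial derivative. -/
theorem boxCoeff_fderiv (hT : ∀ i, 0 < T i) (hφ : IsPeriodicSmooth T φ) (α : Fin p)
    (k : Fin p → ℤ) :
    boxCoeff T (fun t => fderiv ℝ φ t (Pi.single α 1)) k
      = Complex.I * freq T α k * boxCoeff T φ k := by
  have he := isPeriodicSmooth_expMonomial hT (-k)
  -- Integration by parts: the derivative of the periodic function `conj e_k · φ` integrates to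
  -- zero, and the product rule splits it into the two coefficients.
  have hz := setIntegral_fderiv_eq_zero hT ((he.mul hφ).smooth.of_le (by simp)) α
    ((he.mul hφ).periodic α)
  have hd : ∀ t, fderiv ℝ (fun t => expMonomial T (-k) t * φ t) t (Pi.single α 1)
      = conj (expMonomial T k t) * fderiv ℝ φ t (Pi.single α 1)
        - Complex.I * freq T α k * (conj (expMonomial T k t) * φ t) := fun t => by
    rw [fderiv_fun_mul (he.differentiable t) (hφ.differentiable t)]
    simp only [add_apply, smul_apply, smul_eq_mul,
      fderiv_expMonomial, conj_expMonomial, freq_neg]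
    push_cast
    ring
  have hc : Continuous fun t => conj (expMonomial T k t) :=
    (isPeriodicSmooth_expMonomial hT k).star.continuous
  have hi : ∀ {ψ : (Fin p → ℝ) → ℂ}, Continuous ψ →
      Integrable (fun t => conj (expMonomial T k t) * ψ t) (boxMeasure T) := fun hψ =>
    (hc.mul hψ).continuousOn.integrableOn_compact isCompact_Icc
  simp only [hd] at hz
  rw [integral_sub (hi (hφ.continuous_fderiv α)) ((hi hφ.continuous).const_mul _),
    integral_const_mul, sub_eq_zero] at hz
  rw [boxCoeff, boxCoeff, integral_boxProb, integral_boxProb, hz, mul_smul_comm]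

end IsPeriodicSmooth

/-- If the Fourier coefficients of `h'` are those of the partial derivative of `h`, then `h'` is the
weak partial derivative of `h`. -/
theorem setIntegral_mul_fderiv_of_boxCoeff (hT : ∀ i, 0 < T i) {h h' : (Fin p → ℝ) → ℂ}
    (hh : MemLp h 2 (boxMeasure T)) (hh' : MemLp h' 2 (boxMeasure T)) (α : Fin p)
    (hc : ∀ k, boxCoeff T h' k = Complex.I * freq T α k * boxCoeff T h k)
    {φ : (Fin p → ℝ) → ℂ} (hφ : IsPeriodicSmooth T φ) :
    ∫ t in box T, h t * fderiv ℝ φ t (Pi.single α 1) = -∫ t in box T, h' t * φ t := by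
  have h1 := hasSum_boxCoeff hT (memLp_boxProb (memLp_of_continuous hφ.star.continuous 2))
    (memLp_boxProb hh')
  have h2 := hasSum_boxCoeff hT
    (memLp_boxProb (memLp_of_continuous (hφ.star.continuous_fderiv α) 2)) (memLp_boxProb hh)
  have h3 := h1.neg
  -- Both integrals are Parseval sums; they agree termwise because `conj (i ω) = -i ω` supplies the
  -- sign of integration by parts. Conjugating `φ` beforehand removes the conjugate in Parseval's
  -- formula.
  have h4 : (fun k => -(conj (boxCoeff T (fun t => conj (φ t)) k) * boxCoeff T h' k))
      = fun k => conj (boxCoeff T (fun t => fderiv ℝ (fun t => conj (φ t)) t (Pi.single α 1)) k)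
        * boxCoeff T h k := by
    funext k
    rw [hφ.star.boxCoeff_fderiv hT, hc]
    simp only [map_mul, Complex.conj_I, Complex.conj_ofReal]
    ring
  rw [h4] at h3
  have h5 := h2.unique h3
  simp only [hφ.fderiv_star, Complex.conj_conj] at h5
  rw [integral_boxProb, integral_boxProb, ← smul_neg] at h5
  have h6 := smul_right_injective ℂ (ENNReal.toReal_ne_zero.2
    ⟨prod_ofReal_inv_ne_zero hT, prod_ofReal_inv_ne_top T⟩) h5
  simpa only [mul_comm] using h6

/-- The complexified `j`-th component of a field. -/
abbrev comp (u : (Fin p → ℝ) → E n) (j : Fin n) : (Fin p → ℝ) → ℂ := fun t => (u t j : ℂ)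

theorem memLp_comp {μ : Measure (Fin p → ℝ)} {u : (Fin p → ℝ) → E n} (hu : MemLp u 2 μ)
    (j : Fin n) : MemLp (comp u j) 2 μ :=
  (hu.eval_piLp j).ofReal

theorem IsPeriodicTest.comp {f : (Fin p → ℝ) → E n} (hf : IsPeriodicTest T f) (j : Fin n) :
    IsPeriodicSmooth T (comp f j) :=
  ⟨Complex.ofRealCLM.contDiff.comp
    ((EuclideanSpace.proj (𝕜 := ℝ) j).contDiff.comp hf.smooth), fun i t =>
    congrArg (fun x : E n => ((x j : ℝ) : ℂ)) (hf.periodic i t)⟩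

theorem IsPeriodicTest.differentiable {f : (Fin p → ℝ) → E n} (hf : IsPeriodicTest T f) :
    Differentiable ℝ f :=
  hf.smooth.differentiable (by simp)

theorem IsPeriodicTest.fderiv_comp {f : (Fin p → ℝ) → E n} (hf : IsPeriodicTest T f) (j : Fin n)
    (t : Fin p → ℝ) (α : Fin p) :
    fderiv ℝ (PoissonGradient.comp f j) t (Pi.single α 1) = (pderiv α f t j : ℂ) := by
  have h : HasFDerivAt (PoissonGradient.comp f j) _ t := Complex.ofRealCLM.hasFDerivAt.comp t
    ((EuclideanSpace.proj (𝕜 := ℝ) j).hasFDerivAt.comp t (hf.differentiable t).hasFDerivAt)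
  rw [h.fderiv]
  rfl

/-- The test function with a single nonzero component. -/
theorem isPeriodicTest_single {ψ : (Fin p → ℝ) → ℝ} (hs : ContDiff ℝ ∞ ψ)
    (hper : ∀ (i : Fin p) (t : Fin p → ℝ), ψ (t + Pi.single i (T i)) = ψ t) (j : Fin n) :
    IsPeriodicTest T fun t => ψ t • EuclideanSpace.single j (1 : ℝ) :=
  ⟨hs.smul contDiff_const, fun i t => by rw [hper]⟩

theorem pderiv_single {ψ : (Fin p → ℝ) → ℝ} (hs : ContDiff ℝ ∞ ψ) (j : Fin n) (α : Fin p)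
    (t : Fin p → ℝ) :
    pderiv α (fun t => ψ t • EuclideanSpace.single j (1 : ℝ)) t
      = fderiv ℝ ψ t (Pi.single α 1) • EuclideanSpace.single j (1 : ℝ) := by
  have h := ((hs.differentiable (by simp) t).hasFDerivAt).smul_const
    (EuclideanSpace.single j (1 : ℝ))
  rw [pderiv, h.fderiv]
  rfl

theorem inner_smul_single (x : E n) (c : ℝ) (j : Fin n) :
    inner ℝ x (c • EuclideanSpace.single j (1 : ℝ)) = x j * c := by
  rw [inner_smul_right, EuclideanSpace.inner_single_right]
  simp [mul_comm]

/-- An identity which is linear in a real test function extends to complex test functions. -/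
theorem setIntegral_complexify {ι : Type*} [Fintype ι] {h : ι → (Fin p → ℝ) → ℝ}
    {h' : (Fin p → ℝ) → ℝ} (hh : ∀ a, MemLp (h a) 2 (boxMeasure T))
    (hh' : MemLp h' 2 (boxMeasure T)) (β : ι → Fin p)
    (H : ∀ ψ : (Fin p → ℝ) → ℝ, ContDiff ℝ ∞ ψ →
      (∀ (i : Fin p) (t : Fin p → ℝ), ψ (t + Pi.single i (T i)) = ψ t) →
      ∫ t in box T, ∑ a, h a t * fderiv ℝ ψ t (Pi.single (β a) 1) = -∫ t in box T, h' t * ψ t)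
    {φ : (Fin p → ℝ) → ℂ} (hφ : IsPeriodicSmooth T φ) :
    ∫ t in box T, ∑ a, (h a t : ℂ) * fderiv ℝ φ t (Pi.single (β a) 1)
      = -∫ t in box T, (h' t : ℂ) * φ t := by
  have hi1 : Integrable (fun t => ∑ a, (h a t : ℂ) * fderiv ℝ φ t (Pi.single (β a) 1))
      (boxMeasure T) :=
    integrable_finsetSum _ fun a _ =>
      (hh a).ofReal.integrable_mul (memLp_of_continuous (hφ.continuous_fderiv (β a)) 2)
  have hi2 : Integrable (fun t => (h' t : ℂ) * φ t) (boxMeasure T) :=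
    hh'.ofReal.integrable_mul (memLp_of_continuous hφ.continuous 2)
  -- The coefficients `h`, `h'` are real, so the identity separates into the real and the imaginary
  -- part of `φ`.
  have hre := H (fun t => (φ t).re) (Complex.reCLM.contDiff.comp hφ.smooth)
    fun i t => by rw [hφ.periodic]
  have him := H (fun t => (φ t).im) (Complex.imCLM.contDiff.comp hφ.smooth)
    fun i t => by rw [hφ.periodic]
  have hdre : ∀ t α, fderiv ℝ (fun t => (φ t).re) t (Pi.single α 1)
      = (fderiv ℝ φ t (Pi.single α 1)).re := fun t α => by
    have h : HasFDerivAt (fun t => (φ t).re) _ t :=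
      Complex.reCLM.hasFDerivAt.comp t (hφ.differentiable t).hasFDerivAt
    rw [h.fderiv]
    rfl
  have hdim : ∀ t α, fderiv ℝ (fun t => (φ t).im) t (Pi.single α 1)
      = (fderiv ℝ φ t (Pi.single α 1)).im := fun t α => by
    have h : HasFDerivAt (fun t => (φ t).im) _ t :=
      Complex.imCLM.hasFDerivAt.comp t (hφ.differentiable t).hasFDerivAt
    rw [h.fderiv]
    rfl
  simp only [hdre] at hre
  simp only [hdim] at him
  refine Complex.ext ?_ ?_
  · rw [Complex.neg_re]
    refine (integral_re hi1).symm.trans (Eq.trans ?_ (congrArg Neg.neg (integral_re hi2)))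
    simpa using hre
  · rw [Complex.neg_im]
    refine (integral_im hi1).symm.trans (Eq.trans ?_ (congrArg Neg.neg (integral_im hi2)))
    simpa using him

/-- Testing one component at a time against the character `e_{-k} = conj e_k` moves the derivative
onto the character, which it multiplies by `-i ω_α`. -/
theorem HasWeakGradient.boxCoeff (hT : ∀ i, 0 < T i) {u : (Fin p → ℝ) → E n}
    {v : (Fin p → ℝ) → J p n} (hu : MemLp u 2 (boxMeasure T)) (hv : MemLp v 2 (boxMeasure T))
    (h : HasWeakGradient T u v) (α : Fin p) (j : Fin n) (k : Fin p → ℤ) :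
    PoissonGradient.boxCoeff T (comp (fun t => v t α) j) k
      = Complex.I * freq T α k * PoissonGradient.boxCoeff T (comp u j) k := by
  have he := isPeriodicSmooth_expMonomial hT (-k)
  have key := setIntegral_complexify (ι := Unit) (h := fun _ t => u t j) (h' := fun t => v t α j)
    (fun _ => hu.eval_piLp j) ((hv.eval_piLp α).eval_piLp j) (fun _ => α)
    (fun ψ hs hper => by
      have := h _ (isPeriodicTest_single hs hper j) α
      simpa [pderiv_single hs, inner_smul_single] using this) he
  simp only [fderiv_expMonomial, Finset.univ_unique, Finset.sum_singleton, freq_neg] at key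
  have e : ∀ t, ((u t j : ℝ) : ℂ) * (Complex.I * ((-freq T α k : ℝ) : ℂ) * expMonomial T (-k) t)
      = -(Complex.I * freq T α k) * (conj (expMonomial T k t) * comp u j t) := fun t => by
    rw [conj_expMonomial]
    push_cast
    ring
  simp only [e, integral_const_mul] at key
  rw [PoissonGradient.boxCoeff, PoissonGradient.boxCoeff, integral_boxProb, integral_boxProb,
    mul_smul_comm, ← neg_inj, ← smul_neg, ← smul_neg, ← neg_mul, key]
  simp only [conj_expMonomial, mul_comm]

/-- A family of square integrable functions with the right Fourier coefficients gives a weak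
gradient. -/
theorem hasWeakGradient_of_boxCoeff (hT : ∀ i, 0 < T i) {u : (Fin p → ℝ) → E n}
    (hu : MemLp u 2 (boxMeasure T)) {w : Fin p → Fin n → (Fin p → ℝ) → ℂ}
    (hw : ∀ α j, MemLp (w α j) 2 (boxMeasure T))
    (hc : ∀ α j k, boxCoeff T (w α j) k = Complex.I * freq T α k * boxCoeff T (comp u j) k) :
    HasWeakGradient T u
      (fun t => WithLp.toLp 2 fun α => WithLp.toLp 2 fun j => (w α j t).re) := by
  intro f hf α
  have hi1 : ∀ j, Integrable (fun t => u t j * pderiv α f t j) (boxMeasure T) := fun j =>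
    (hu.eval_piLp j).integrable_mul
      ((memLp_of_continuous (hf.continuous_pderiv α) 2).eval_piLp j)
  have hi2 : ∀ j, Integrable (fun t => w α j t * comp f j t) (boxMeasure T) := fun j =>
    (hw α j).integrable_mul (memLp_of_continuous (hf.comp j).continuous 2)
  have hi3 : ∀ j, Integrable (fun t => (w α j t).re * f t j) (boxMeasure T) := fun j =>
    (hi2 j).re.congr (Eventually.of_forall fun t => by simp)
  have key : ∀ j, ∫ t in box T, u t j * pderiv α f t j = -∫ t in box T, (w α j t).re * f t j := by
    intro j
    have h1 := setIntegral_mul_fderiv_of_boxCoeff hT (memLp_comp hu j) (hw α j) α (hc α j)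
      (hf.comp j)
    simp only [hf.fderiv_comp, ← Complex.ofReal_mul] at h1
    rw [integral_complex_ofReal] at h1
    -- `w` may be complex-valued, but `u` and `f` are real, so only the real part of `w` enters.
    have h2 := congrArg Complex.re h1
    rw [Complex.ofReal_re, Complex.neg_re] at h2
    refine h2.trans (congrArg Neg.neg ((integral_re (hi2 j)).symm.trans ?_))
    simp
  have e1 : ∀ t, (inner ℝ (u t) (pderiv α f t) : ℝ) = ∑ j, u t j * pderiv α f t j := fun t => by
    simp [PiLp.inner_apply, mul_comm]
  have e2 : ∀ t, (inner ℝ ((WithLp.toLp 2 fun j => (w α j t).re : E n)) (f t) : ℝ)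
      = ∑ j, (w α j t).re * f t j := fun t => by
    simp [PiLp.inner_apply, mul_comm]
  simp only [e1, e2]
  rw [integral_finsetSum _ fun j _ => hi1 j, integral_finsetSum _ fun j _ => hi3 j,
    ← Finset.sum_neg_distrib]
  exact Finset.sum_congr rfl fun j _ => key j

end PoissonGradient

end

/-! ### Density of smooth functions, Poincaré–Wirtinger, elliptic regularity. -/

noncomputable section

namespace PoissonGradient

open scoped ENNReal ComplexConjugate

variable {p n : ℕ} {T : Fin p → ℝ}

/-- The partial sums of the Fourier series of a field. -/
def fourierPartial (T : Fin p → ℝ) (u : (Fin p → ℝ) → E n) (S : Finset (Fin p → ℤ))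
    (t : Fin p → ℝ) : E n :=
  WithLp.toLp 2 fun j => (∑ k ∈ S, boxCoeff T (comp u j) k * expMonomial T k t).re

theorem isPeriodicTest_fourierPartial (hT : ∀ i, 0 < T i) (u : (Fin p → ℝ) → E n)
    (S : Finset (Fin p → ℤ)) : IsPeriodicTest T (fourierPartial T u S) := by
  refine ⟨contDiff_piLp _ |>.2 fun j => ?_, fun i t => ?_⟩
  · exact Complex.reCLM.contDiff.comp (ContDiff.sum fun k _ =>
      contDiff_const.mul (isPeriodicSmooth_expMonomial hT k).smooth)
  · simp only [fourierPartial, (isPeriodicSmooth_expMonomial hT _).periodic]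

/-- Differentiation multiplies `e_k` by `i ω_α`, the very factor relating the coefficients of `v`
and `u`. Truncation thus commutes with the weak derivative. -/
theorem pderiv_fourierPartial (hT : ∀ i, 0 < T i) {u v : (Fin p → ℝ) → E n} {α : Fin p}
    (h : ∀ j k, boxCoeff T (comp v j) k = Complex.I * freq T α k * boxCoeff T (comp u j) k)
    (S : Finset (Fin p → ℤ)) :
    pderiv α (fourierPartial T u S) = fourierPartial T v S := by
  funext t
  refine PiLp.ext fun j => ?_
  have h1 := (isPeriodicTest_fourierPartial hT u S).fderiv_comp j t α
  have h2 : HasFDerivAt (fun t => ∑ k ∈ S, boxCoeff T (comp u j) k * expMonomial T k t)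
      (∑ k ∈ S, boxCoeff T (comp u j) k • fderiv ℝ (expMonomial T k) t) t :=
    HasFDerivAt.fun_sum fun k _ =>
      ((isPeriodicSmooth_expMonomial hT k).differentiable t).hasFDerivAt.const_mul _
  have h3 : HasFDerivAt (comp (fourierPartial T u S) j)
      ((Complex.ofRealCLM.comp Complex.reCLM).comp
        (∑ k ∈ S, boxCoeff T (comp u j) k • fderiv ℝ (expMonomial T k) t)) t :=
    (Complex.ofRealCLM.comp Complex.reCLM).hasFDerivAt.comp t h2
  rw [h3.fderiv] at h1
  have h4 : ((∑ k ∈ S, boxCoeff T (comp u j) k • fderiv ℝ (expMonomial T k) t)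
      (Pi.single α 1)).re = pderiv α (fourierPartial T u S) t j := Complex.ofReal_injective h1
  rw [← h4]
  simp only [fourierPartial]
  congr 1
  rw [sum_apply]
  refine Finset.sum_congr rfl fun k _ => ?_
  rw [smul_apply, fderiv_expMonomial, h, smul_eq_mul]
  ring

theorem norm_le_sum_norm (x : E n) : ‖x‖ ≤ ∑ j, ‖x j‖ := by
  rw [EuclideanSpace.norm_eq]
  refine Real.sqrt_le_iff.2 ⟨Finset.sum_nonneg fun j _ => norm_nonneg _, ?_⟩
  exact Finset.sum_sq_le_sq_sum_of_nonneg fun j _ => norm_nonneg _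

theorem eLpNorm_boxMeasure (hT : ∀ i, 0 < T i) {V : Type*} [NormedAddCommGroup V]
    (h : (Fin p → ℝ) → V) :
    eLpNorm h 2 (boxMeasure T)
      = ((∏ i, ENNReal.ofReal (T i)⁻¹)⁻¹) ^ (1 / (2 : ℝ≥0∞)).toReal * eLpNorm h 2 (boxProb T) := by
  rw [boxMeasure_eq_smul hT, eLpNorm_smul_measure_of_ne_top (by simp), smul_eq_mul]

theorem tendsto_eLpNorm_fourierPartial (hT : ∀ i, 0 < T i) {u : (Fin p → ℝ) → E n}
    (hu : MemLp u 2 (boxMeasure T)) :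
    Tendsto (fun S => eLpNorm (fun t => fourierPartial T u S t - u t) 2 (boxMeasure T))
      atTop (𝓝 0) := by
  have h1 : ∀ j, Tendsto (fun S : Finset (Fin p → ℤ) =>
      eLpNorm (fun t => (∑ k ∈ S, boxCoeff T (comp u j) k * expMonomial T k t) - comp u j t) 2
        (boxMeasure T)) atTop (𝓝 0) := fun j => by
    simp only [eLpNorm_boxMeasure hT]
    have := ENNReal.Tendsto.const_mul
      (tendsto_eLpNorm_fourier hT (memLp_boxProb (memLp_comp hu j)))
      (Or.inr (ENNReal.rpow_ne_top_of_nonneg (y := (1 / (2 : ℝ≥0∞)).toReal) ENNReal.toReal_nonneg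
        (ENNReal.inv_ne_top.2 (prod_ofReal_inv_ne_zero hT))))
    simpa only [mul_zero] using this
  have h2 := tendsto_finsetSum Finset.univ fun j _ => h1 j
  rw [Finset.sum_const_zero] at h2
  refine tendsto_of_tendsto_of_tendsto_of_le_of_le tendsto_const_nhds h2
    (fun _ => zero_le) fun S => ?_
  have hm : ∀ j, AEStronglyMeasurable (fun t =>
      ‖(∑ k ∈ S, boxCoeff T (comp u j) k * expMonomial T k t) - comp u j t‖) (boxMeasure T) :=
    fun j => (((Finset.measurable_fun_sum S fun k _ =>
      (measurable_expMonomial T k).const_mul _).aestronglyMeasurable).sub (memLp_comp hu j).1).norm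
  refine le_trans ?_ ((eLpNorm_sum_le (f := fun j t =>
      ‖(∑ k ∈ S, boxCoeff T (comp u j) k * expMonomial T k t) - comp u j t‖)
      (s := Finset.univ) (fun j _ => hm j) (by norm_num)).trans
      (le_of_eq (Finset.sum_congr rfl fun j _ => eLpNorm_norm _)))
  refine eLpNorm_mono_real fun t => (norm_le_sum_norm _).trans ?_
  rw [Finset.sum_apply]
  refine Finset.sum_le_sum fun j _ => ?_
  -- The index set `S` need not be symmetric, so the partial sums may be complex; as `u` is real,
  -- taking real parts does not increase the error.
  have := Complex.abs_re_le_norm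
    ((∑ k ∈ S, boxCoeff T (comp u j) k * expMonomial T k t) - comp u j t)
  rwa [Complex.sub_re, Complex.ofReal_re] at this

/-- **Meyers–Serrin**: smooth periodic functions are dense in the periodic Sobolev space. -/
theorem exists_isPeriodicTest_near (hT : ∀ i, 0 < T i) {u : (Fin p → ℝ) → E n}
    {v : (Fin p → ℝ) → J p n} (hu : MemLp u 2 (boxMeasure T)) (hv : MemLp v 2 (boxMeasure T))
    (h : HasWeakGradient T u v) {ε : ℝ≥0∞} (hε : 0 < ε) :
    ∃ f, IsPeriodicTest T f ∧ eLpNorm (fun t => f t - u t) 2 (boxMeasure T) ≤ ε ∧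
      ∀ α, eLpNorm (fun t => pderiv α f t - v t α) 2 (boxMeasure T) ≤ ε := by
  have h1 := (tendsto_eLpNorm_fourierPartial hT hu).eventually_le_const hε
  have h2 : ∀ α, ∀ᶠ S in atTop, eLpNorm
      (fun t => pderiv α (fourierPartial T u S) t - v t α) 2 (boxMeasure T) ≤ ε := fun α => by
    have := (tendsto_eLpNorm_fourierPartial hT (hv.eval_piLp α)).eventually_le_const hε
    filter_upwards [this] with S hS
    rwa [pderiv_fourierPartial hT fun j k => h.boxCoeff hT hu hv α j k]
  -- One truncation serves `u` and all its finitely many derivatives, since the derivatives of the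
  -- partial sums are partial sums themselves.
  obtain ⟨S, hS1, hS2⟩ := (h1.and (eventually_all.2 h2)).exists
  exact ⟨_, isPeriodicTest_fourierPartial hT u S, hS1, hS2⟩

theorem isProbabilityMeasure_boxProb (hT : ∀ i, 0 < T i) : IsProbabilityMeasure (boxProb T) := by
  rw [← (measurePreserving_ofTorus hT).map_eq]
  exact Measure.isProbabilityMeasure_map (measurable_ofTorus T).aemeasurable

theorem boxCoeff_zero_right (T : Fin p → ℝ) (h : (Fin p → ℝ) → ℂ) :
    boxCoeff T h 0 = ∫ t, h t ∂boxProb T := by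
  simp [boxCoeff, expMonomial, UnitAddTorus.mFourier_zero]

theorem freq_ne_zero (hT : ∀ i, 0 < T i) {k : Fin p → ℤ} {α : Fin p} (hk : k α ≠ 0) :
    freq T α k ≠ 0 :=
  div_ne_zero (mul_ne_zero (by positivity) (Int.cast_ne_zero.2 hk)) (hT α).ne'

theorem isPeriodicSmooth_const (T : Fin p → ℝ) (c : ℂ) : IsPeriodicSmooth T fun _ => c :=
  ⟨contDiff_const, fun _ _ => rfl⟩

/-- The derivative of a constant vanishes, so its coefficients satisfy `i ω_α c_k = 0`, with `ω_α ≠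
0` for a suitable `α`. -/
theorem boxCoeff_const (hT : ∀ i, 0 < T i) (c : ℂ) {k : Fin p → ℤ} (hk : k ≠ 0) :
    boxCoeff T (fun _ => c) k = 0 := by
  obtain ⟨α, hα⟩ := Function.ne_iff.1 hk
  have h := (isPeriodicSmooth_const T c).boxCoeff_fderiv hT α k
  have h0 : boxCoeff T (fun t : Fin p → ℝ => fderiv ℝ (fun _ => c) t (Pi.single α 1)) k = 0 := by
    simp [boxCoeff]
  rw [h0] at h
  exact (mul_eq_zero.1 h.symm).resolve_left
    (mul_ne_zero Complex.I_ne_zero (Complex.ofReal_ne_zero.2 (freq_ne_zero hT hα)))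

theorem integrable_conj_expMonomial_mul (hT : ∀ i, 0 < T i) {h : (Fin p → ℝ) → ℂ}
    (hh : MemLp h 2 (boxProb T)) (k : Fin p → ℤ) :
    Integrable (fun t => conj (expMonomial T k t) * h t) (boxProb T) :=
  (memLp_boxProb (memLp_of_continuous
    (isPeriodicSmooth_expMonomial hT k).star.continuous 2)).integrable_mul hh

/-- **Poincaré–Wirtinger inequality** for scalar functions, in terms of Fourier coefficients. -/
theorem integral_norm_sq_sub_mean_le (hT : ∀ i, 0 < T i) {h : (Fin p → ℝ) → ℂ}
    {h' : Fin p → (Fin p → ℝ) → ℂ} (hh : MemLp h 2 (boxProb T))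
    (hh' : ∀ α, MemLp (h' α) 2 (boxProb T))
    (hc : ∀ α k, boxCoeff T (h' α) k = Complex.I * freq T α k * boxCoeff T h k) :
    ∫ t, ‖h t - ∫ s, h s ∂boxProb T‖ ^ 2 ∂boxProb T
      ≤ (∑ α, (T α / (2 * Real.pi)) ^ 2) * ∑ α, ∫ t, ‖h' α t‖ ^ 2 ∂boxProb T := by
  have := isProbabilityMeasure_boxProb hT
  set m := ∫ s, h s ∂boxProb T with hm
  have hconst : MemLp (fun _ : Fin p → ℝ => m) 2 (boxProb T) := memLp_const m
  have hsub : ∀ k, boxCoeff T (fun t => h t - m) k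
      = boxCoeff T h k - boxCoeff T (fun _ => m) k := fun k => by
    simp only [boxCoeff, mul_sub]
    exact integral_sub (integrable_conj_expMonomial_mul hT hh k)
      (integrable_conj_expMonomial_mul hT hconst k)
  have h1 := hasSum_norm_sq_boxCoeff hT (hh.sub hconst)
  have h2 := (hasSum_sum fun α (_ : α ∈ Finset.univ) =>
    hasSum_norm_sq_boxCoeff hT (hh' α)).mul_left (∑ α, (T α / (2 * Real.pi)) ^ 2)
  -- By Parseval it suffices to compare coefficients. At `k = 0` subtracting the mean leaves
  -- nothing; otherwise some `k α ≠ 0`, and `|k α| ≥ 1` bounds the coefficient by that of the `α`-th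
  -- derivative.
  refine hasSum_le (fun k => ?_) h1 h2
  change ‖boxCoeff T (fun t => h t - m) k‖ ^ 2 ≤ _
  have hC : 0 ≤ ∑ α, (T α / (2 * Real.pi)) ^ 2 := Finset.sum_nonneg fun α _ => sq_nonneg _
  by_cases hk : k = 0
  · rw [hsub, hk, boxCoeff_zero_right, boxCoeff_zero_right, ← hm]
    simp only [integral_const, probReal_univ, one_smul, sub_self, norm_zero]
    exact le_trans (by norm_num)
      (mul_nonneg hC (Finset.sum_nonneg fun α _ => sq_nonneg ‖boxCoeff T (h' α) 0‖))
  · rw [hsub, boxCoeff_const hT m hk, sub_zero]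
    obtain ⟨α, hα⟩ := Function.ne_iff.1 hk
    have e1 : ‖boxCoeff T h k‖ ^ 2 ≤ (T α / (2 * Real.pi)) ^ 2 * ‖boxCoeff T (h' α) k‖ ^ 2 := by
      rw [hc, norm_mul, norm_mul, Complex.norm_I, one_mul, Complex.norm_real, mul_pow,
        Real.norm_eq_abs, sq_abs, ← mul_assoc, ← mul_pow]
      have e2 : T α / (2 * Real.pi) * freq T α k = k α := by
        rw [freq]
        have := (hT α).ne'
        field_simp
      rw [e2]
      refine le_mul_of_one_le_left (sq_nonneg _) ?_
      have e3 : (1 : ℤ) ≤ k α ^ 2 := Int.one_le_abs hα |> fun h => by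
        rw [← sq_abs]; nlinarith
      exact_mod_cast e3
    -- The direction `α` depends on `k`; summing both factors over all directions makes the bound
    -- uniform.
    refine e1.trans (mul_le_mul ?_ ?_ (sq_nonneg _) hC)
    · exact Finset.single_le_sum (f := fun α => (T α / (2 * Real.pi)) ^ 2)
        (fun α _ => sq_nonneg _) (Finset.mem_univ α)
    · exact Finset.single_le_sum (f := fun α => ‖boxCoeff T (h' α) k‖ ^ 2)
        (fun α _ => sq_nonneg _) (Finset.mem_univ α)

/-- **Poincaré–Wirtinger inequality**. -/
theorem HasWeakGradient.setIntegral_norm_sq_sub_mean_le (hT : ∀ i, 0 < T i)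
    {u : (Fin p → ℝ) → E n} {v : (Fin p → ℝ) → J p n} (hu : MemLp u 2 (boxMeasure T))
    (hv : MemLp v 2 (boxMeasure T)) (h : HasWeakGradient T u v) :
    ∫ t in box T, ‖u t - ∫ s, u s ∂boxProb T‖ ^ 2
      ≤ (∑ α, (T α / (2 * Real.pi)) ^ 2) * ∫ t in box T, ‖v t‖ ^ 2 := by
  have := isProbabilityMeasure_boxProb hT
  have hu' := memLp_boxProb hu
  have hv' := memLp_boxProb hv
  set m := ∫ s, u s ∂boxProb T with hm
  have hmj : ∀ j, ∫ s, comp u j s ∂boxProb T = (m j : ℂ) := fun j => by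
    rw [integral_complex_ofReal, hm]
    congr 1
    exact (EuclideanSpace.proj (𝕜 := ℝ) j).integral_comp_comm (hu'.integrable (by norm_num))
  have key : ∀ j, ∫ t, ‖u t j - m j‖ ^ 2 ∂boxProb T
      ≤ (∑ α, (T α / (2 * Real.pi)) ^ 2) * ∑ α, ∫ t, ‖v t α j‖ ^ 2 ∂boxProb T := fun j => by
    have := integral_norm_sq_sub_mean_le hT (memLp_comp hu' j)
      (fun α => memLp_comp (hv'.eval_piLp α) j) (fun α k => h.boxCoeff hT hu hv α j k)
    simpa only [hmj, ← Complex.ofReal_sub, Complex.norm_real] using this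
  have hi1 : ∀ j, Integrable (fun t => ‖u t j - m j‖ ^ 2) (boxProb T) := fun j =>
    ((hu'.eval_piLp j).sub (memLp_const (m j))).integrable_norm_pow (by norm_num)
  have hi2 : ∀ α j, Integrable (fun t => ‖v t α j‖ ^ 2) (boxProb T) := fun α j =>
    ((hv'.eval_piLp α).eval_piLp j).integrable_norm_pow (by norm_num)
  have e1 : ∫ t, ‖u t - m‖ ^ 2 ∂boxProb T = ∑ j, ∫ t, ‖u t j - m j‖ ^ 2 ∂boxProb T := by
    rw [← integral_finsetSum _ fun j _ => hi1 j]
    refine integral_congr_ae (Eventually.of_forall fun t => ?_)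
    exact EuclideanSpace.norm_sq_eq _
  have e2 : ∫ t, ‖v t‖ ^ 2 ∂boxProb T = ∑ j, ∑ α, ∫ t, ‖v t α j‖ ^ 2 ∂boxProb T := by
    rw [Finset.sum_comm]
    simp only [← integral_finsetSum _ fun j _ => hi2 _ j]
    rw [← integral_finsetSum _ fun α _ => integrable_finsetSum _ fun j _ => hi2 α j]
    refine integral_congr_ae (Eventually.of_forall fun t => ?_)
    change ‖v t‖ ^ 2 = ∑ α, ∑ j, ‖v t α j‖ ^ 2
    rw [PiLp.norm_sq_eq_of_L2]
    exact Finset.sum_congr rfl fun α _ => EuclideanSpace.norm_sq_eq _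
  have e3 : ∫ t, ‖u t - m‖ ^ 2 ∂boxProb T
      ≤ (∑ α, (T α / (2 * Real.pi)) ^ 2) * ∫ t, ‖v t‖ ^ 2 ∂boxProb T := by
    rw [e1, e2, Finset.mul_sum]
    exact Finset.sum_le_sum fun j _ => key j
  rw [integral_boxProb, integral_boxProb, mul_smul_comm] at e3
  exact le_of_smul_le_smul_left e3 (ENNReal.toReal_pos (prod_ofReal_inv_ne_zero hT)
    (prod_ofReal_inv_ne_top T))

/-- As for weak gradients, by testing against `e_{-k}`; here all directions occur at once, so their
factors `i ω_α` are summed. -/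
theorem boxCoeff_of_weakDivergence (hT : ∀ i, 0 < T i) {v : (Fin p → ℝ) → J p n}
    {w : (Fin p → ℝ) → E n} (hv : MemLp v 2 (boxMeasure T)) (hw : MemLp w 2 (boxMeasure T))
    (h : ∀ f : (Fin p → ℝ) → E n, IsPeriodicTest T f →
      ∫ t in box T, ∑ α : Fin p, inner ℝ (v t α) (pderiv α f t)
        = - ∫ t in box T, inner ℝ (w t) (f t)) (j : Fin n) (k : Fin p → ℤ) :
    boxCoeff T (comp w j) k
      = ∑ α, Complex.I * freq T α k * boxCoeff T (comp (fun t => v t α) j) k := by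
  have key := setIntegral_complexify (h := fun α t => v t α j) (h' := fun t => w t j)
    (fun α => (hv.eval_piLp α).eval_piLp j) (hw.eval_piLp j) (fun α => α)
    (fun ψ hs hper => by
      have := h _ (isPeriodicTest_single hs hper j)
      simpa only [pderiv_single hs, inner_smul_single] using this)
    (isPeriodicSmooth_expMonomial hT (-k))
  have e : ∀ t, ∑ α, ((v t α j : ℝ) : ℂ) * fderiv ℝ (expMonomial T (-k)) t (Pi.single α 1)
      = ∑ α, -(Complex.I * freq T α k)
        * (conj (expMonomial T k t) * comp (fun t => v t α) j t) := fun t => by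
    refine Finset.sum_congr rfl fun α _ => ?_
    rw [conj_expMonomial, fderiv_expMonomial, freq_neg]
    push_cast
    ring
  have hi : ∀ α, Integrable (fun t => -(Complex.I * freq T α k)
        * (conj (expMonomial T k t) * comp (fun t => v t α) j t)) (boxMeasure T) := fun α =>
    ((memLp_of_continuous (isPeriodicSmooth_expMonomial hT k).star.continuous 2).integrable_mul
      (memLp_comp (hv.eval_piLp α) j)).const_mul _
  simp only [e] at key
  rw [integral_finsetSum _ fun α _ => hi α] at key
  simp only [integral_const_mul] at key
  simp only [neg_mul, Finset.sum_neg_distrib] at key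
  simp only [boxCoeff, integral_boxProb, mul_smul_comm]
  rw [← Finset.smul_sum, neg_injective key]
  simp only [conj_expMonomial, mul_comm]

/-- **Elliptic regularity**: if `u` has a square integrable weak Laplacian, then its first
derivatives have square integrable weak gradients. -/
theorem HasWeakGradient.exists_hasWeakGradient_of_weakLaplacian (hT : ∀ i, 0 < T i)
    {u w : (Fin p → ℝ) → E n} {v : (Fin p → ℝ) → J p n} (hu : MemLp u 2 (boxMeasure T))
    (hv : MemLp v 2 (boxMeasure T)) (hw : MemLp w 2 (boxMeasure T)) (h : HasWeakGradient T u v)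
    (hL : ∀ f : (Fin p → ℝ) → E n, IsPeriodicTest T f →
      ∫ t in box T, ∑ α : Fin p, inner ℝ (v t α) (pderiv α f t)
        = - ∫ t in box T, inner ℝ (w t) (f t)) (α : Fin p) :
    ∃ z : (Fin p → ℝ) → J p n, MemLp z 2 (boxMeasure T) ∧
      HasWeakGradient T (fun t => v t α) z := by
  -- In terms of `u`, the second derivative has symbol `-ω_α ω_β` and the Laplacian `-∑ ω_a²`; the
  -- latter dominates because `2 |ω_α ω_β| ≤ ω_α² + ω_β²`.
  have hb : ∀ (β : Fin p) (j : Fin n) (k : Fin p → ℤ),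
      ‖Complex.I * freq T β k * PoissonGradient.boxCoeff T (comp (fun t => v t α) j) k‖
        ≤ ‖PoissonGradient.boxCoeff T (comp w j) k‖ := fun β j k => by
    rw [boxCoeff_of_weakDivergence hT hv hw hL, h.boxCoeff hT hu hv]
    simp only [h.boxCoeff hT hu hv, ← mul_assoc]
    rw [← Finset.sum_mul, norm_mul, norm_mul (∑ a, _)]
    refine mul_le_mul_of_nonneg_right ?_ (norm_nonneg _)
    have e : ∀ a b : Fin p, Complex.I * freq T a k * Complex.I * freq T b k
        = ((-(freq T a k * freq T b k) : ℝ) : ℂ) := fun a b => by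
      push_cast
      linear_combination (freq T a k * freq T b k : ℂ) * Complex.I_mul_I
    simp only [e, ← Complex.ofReal_sum]
    rw [Complex.norm_real, Complex.norm_real, Finset.sum_neg_distrib, norm_neg, norm_neg,
      Real.norm_eq_abs, Real.norm_eq_abs]
    have hs : ∀ a, freq T a k * freq T a k ≤ ∑ a, freq T a k * freq T a k := fun a =>
      Finset.single_le_sum (f := fun a => freq T a k * freq T a k)
        (fun a _ => mul_self_nonneg _) (Finset.mem_univ a)
    refine le_trans ?_ (le_abs_self _)
    refine abs_le.2 ⟨?_, ?_⟩
    · nlinarith [hs α, hs β, sq_nonneg (freq T α k + freq T β k)]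
    · nlinarith [hs α, hs β, sq_nonneg (freq T α k - freq T β k)]
  have hsum : ∀ (β : Fin p) (j : Fin n), Summable fun k =>
      ‖Complex.I * freq T β k * PoissonGradient.boxCoeff T (comp (fun t => v t α) j) k‖ ^ 2 :=
    fun β j => (hasSum_norm_sq_boxCoeff hT (memLp_boxProb (memLp_comp hw j))).summable.of_nonneg_of_le
      (fun k => sq_nonneg _) fun k => pow_le_pow_left₀ (norm_nonneg _) (hb β j k) 2
  -- The candidate second derivatives are built from their coefficients by Riesz–Fischer.
  choose z hz1 hz2 using fun β j => exists_boxCoeff_eq hT (hsum β j)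
  refine ⟨_, ?_, hasWeakGradient_of_boxCoeff hT (hv.eval_piLp α)
    (fun β j => memLp_boxMeasure hT (hz1 β j)) hz2⟩
  exact MemLp.of_eval_piLp fun β => MemLp.of_eval_piLp fun j => (memLp_boxMeasure hT (hz1 β j)).re

end PoissonGradient

end

/-! ### Traces on the faces. -/

noncomputable section

namespace PoissonGradient

open scoped ENNReal ComplexConjugate

variable {p n : ℕ} {T : Fin p → ℝ}

theorem eLpNorm_two_sq {α V : Type*} [MeasurableSpace α] [NormedAddCommGroup V] (f : α → V)
    (μ : Measure α) : eLpNorm f 2 μ ^ 2 = ∫⁻ x, ‖f x‖ₑ ^ 2 ∂μ := by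
  have := eLpNorm_nnreal_pow_eq_lintegral (f := f) (μ := μ) (p := 2) two_ne_zero
  simpa using this

/-- **Trace inequality**. -/
theorem lintegral_face_le (hT : ∀ i, 0 < T i) {f : (Fin p → ℝ) → E n} (hf : ContDiff ℝ 1 f)
    (i : Fin p) :
    ENNReal.ofReal (T i) * ∫⁻ t' in face T i, ‖f (glue i t' 0)‖ₑ ^ 2
      ≤ (1 + ENNReal.ofReal (T i))
        * ((∫⁻ t in box T, ‖f t‖ₑ ^ 2) + ∫⁻ t in box T, ‖pderiv i f t‖ₑ ^ 2) := by
  -- The slab estimate is applied to `|f|²` on a slab of width `T i`, which is the whole box; the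
  -- derivative `2 (f, ∂f)` is at most `|f|² + |∂f|²`.
  have hG : ContDiff ℝ 1 fun t => ‖f t‖ ^ 2 := hf.norm_sq ℝ
  have key := lintegral_slab_sub_le hT hG i (c := 0) (Or.inl rfl) (hT i).le
  have hbox : box T ∩ {t | |t i - 0| ≤ T i} = box T := by
    refine Set.inter_eq_left.2 fun t ht => ?_
    simpa [abs_of_nonneg (ht.1 i)] using ht.2 i
  rw [hbox] at key
  have hproj : Continuous fun t : Fin p → ℝ => glue i (fun j : {j : Fin p // j ≠ i} => t j) 0 := by
    have h1 : Continuous fun t : Fin p → ℝ => (fun j : {j : Fin p // j ≠ i} => t j) :=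
      continuous_pi fun j => continuous_apply (j : Fin p)
    exact (continuous_glue i).comp (h1.prodMk continuous_const)
  have hd : ∀ t, ‖fderiv ℝ (fun t => ‖f t‖ ^ 2) t (Pi.single i 1)‖ₑ
      ≤ ‖f t‖ₑ ^ 2 + ‖pderiv i f t‖ₑ ^ 2 := fun t => by
    have h1 := ((hf.differentiable one_ne_zero t).hasFDerivAt).norm_sq
    rw [h1.fderiv]
    have h2 : ‖(2 * inner ℝ (f t) (pderiv i f t) : ℝ)‖ ≤ ‖f t‖ ^ 2 + ‖pderiv i f t‖ ^ 2 := by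
      rw [norm_mul, Real.norm_eq_abs 2, abs_two]
      have := norm_inner_le_norm (𝕜 := ℝ) (f t) (pderiv i f t)
      nlinarith [sq_nonneg (‖f t‖ - ‖pderiv i f t‖)]
    have h3 := ENNReal.ofReal_le_ofReal h2
    rw [ENNReal.ofReal_add (sq_nonneg _) (sq_nonneg _), ENNReal.ofReal_pow (norm_nonneg _),
      ENNReal.ofReal_pow (norm_nonneg _), ofReal_norm, ofReal_norm, ofReal_norm] at h3
    simpa [pderiv, two_smul, two_mul] using h3
  have hm : Measurable fun t => ‖f t‖ₑ ^ 2 := hf.continuous.enorm.measurable.pow_const 2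
  have hme : ∀ x : E n, ‖(‖x‖ ^ 2 : ℝ)‖ₑ = ‖x‖ₑ ^ 2 := fun x => by
    rw [← ofReal_norm, norm_pow, norm_norm, ENNReal.ofReal_pow (norm_nonneg _), ofReal_norm]
  have h0 : ∫⁻ t in box T, ‖f (glue i (fun j => t j) 0)‖ₑ ^ 2
      = ENNReal.ofReal (T i) * ∫⁻ t' in face T i, ‖f (glue i t' 0)‖ₑ ^ 2 := by
    have hb : box T = box T ∩ {t | t i ∈ Set.univ} := by simp
    rw [hb, lintegral_slab T i Set.univ (f := fun t => ‖f (glue i (fun j => t j) 0)‖ₑ ^ 2)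
      (hm.comp hproj.measurable)]
    simp only [glue_coe, setLIntegral_const, Set.inter_univ, Real.volume_Icc, sub_zero]
    have hm' : Measurable fun t' => ‖f (glue i t' 0)‖ₑ ^ 2 :=
      hm.comp ((continuous_glue i).comp (continuous_id.prodMk continuous_const)).measurable
    exact (lintegral_mul_const _ hm').trans (mul_comm _ _)
  rw [← h0]
  calc ∫⁻ t in box T, ‖f (glue i (fun j => t j) 0)‖ₑ ^ 2
      ≤ ∫⁻ t in box T, (‖f t‖ₑ ^ 2 + ‖‖f t‖ ^ 2 - ‖f (glue i (fun j => t j) 0)‖ ^ 2‖ₑ) := by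
        refine lintegral_mono fun t => ?_
        rw [← hme, ← hme]
        have := enorm_sub_le (E := ℝ) (a := ‖f t‖ ^ 2)
          (b := ‖f t‖ ^ 2 - ‖f (glue i (fun j => t j) 0)‖ ^ 2)
        rwa [sub_sub_cancel] at this
    _ = (∫⁻ t in box T, ‖f t‖ₑ ^ 2)
        + ∫⁻ t in box T, ‖‖f t‖ ^ 2 - ‖f (glue i (fun j => t j) 0)‖ ^ 2‖ₑ :=
        lintegral_add_left hm _
    _ ≤ (∫⁻ t in box T, ‖f t‖ₑ ^ 2) + ENNReal.ofReal (T i)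
        * ((∫⁻ t in box T, ‖f t‖ₑ ^ 2) + ∫⁻ t in box T, ‖pderiv i f t‖ₑ ^ 2) := by
        rw [← lintegral_add_left hm fun t => ‖pderiv i f t‖ₑ ^ 2]
        exact add_le_add_right (key.trans (mul_le_mul_right (lintegral_mono hd) _)) _
    _ ≤ _ := by
        rw [add_mul, one_mul]
        exact add_le_add_left le_self_add _

/-- The trace inequality as a bound with a constant independent of `f`, so that Cauchy sequences in
the Sobolev norm have Cauchy traces. -/
theorem exists_eLpNorm_face_le (hT : ∀ i, 0 < T i) (n : ℕ) (i : Fin p) :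
    ∃ D : ℝ≥0∞, D ≠ ⊤ ∧ ∀ f : (Fin p → ℝ) → E n, ContDiff ℝ 1 f → ∀ δ : ℝ≥0∞,
      eLpNorm f 2 (boxMeasure T) ≤ δ → eLpNorm (pderiv i f) 2 (boxMeasure T) ≤ δ →
      eLpNorm (fun t' => f (glue i t' 0)) 2 (volume.restrict (face T i)) ≤ D * δ := by
  set c := ENNReal.ofReal (T i) with hc
  have hc0 : c ≠ 0 := by simpa [hc] using hT i
  have hct : c ≠ ⊤ := ENNReal.ofReal_ne_top
  set K := c⁻¹ * ((1 + c) * 2) with hK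
  -- `1 + K` replaces `√K`: its square dominates `K`, which avoids a root.
  refine ⟨1 + K, ?_, fun f hf δ h1 h2 => ?_⟩
  · have : c⁻¹ ≠ ⊤ := ENNReal.inv_ne_top.2 hc0
    finiteness
  · have key := lintegral_face_le hT hf i
    rw [← eLpNorm_two_sq, ← eLpNorm_two_sq, ← eLpNorm_two_sq] at key
    refine (ENNReal.pow_le_pow_left_iff two_ne_zero).1 ?_
    calc eLpNorm (fun t' => f (glue i t' 0)) 2 (volume.restrict (face T i)) ^ 2
        = c⁻¹ * (c * eLpNorm (fun t' => f (glue i t' 0)) 2 (volume.restrict (face T i)) ^ 2) := by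
          rw [← mul_assoc, ENNReal.inv_mul_cancel hc0 hct, one_mul]
      _ ≤ c⁻¹ * ((1 + c) * (δ ^ 2 + δ ^ 2)) := by
          refine mul_le_mul_right (key.trans (mul_le_mul_right ?_ _)) _
          gcongr
      _ = K * δ ^ 2 := by rw [hK, ← two_mul]; ring
      _ ≤ (1 + K) ^ 2 * δ ^ 2 := by
          refine mul_le_mul_left ?_ _
          calc K ≤ 1 + K := le_add_self
            _ ≤ (1 + K) * (1 + K) := le_mul_of_one_le_left' le_self_add
            _ = (1 + K) ^ 2 := (sq _).symm
      _ = ((1 + K) * δ) ^ 2 := (mul_pow _ _ _).symm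

/-- Cauchy–Schwarz against the constant `1`. -/
theorem lintegral_enorm_le_eLpNorm_two {α V : Type*} [MeasurableSpace α] [NormedAddCommGroup V]
    {f : α → V} {μ : Measure α} (hf : AEStronglyMeasurable f μ) :
    ∫⁻ x, ‖f x‖ₑ ∂μ ≤ eLpNorm f 2 μ * μ Set.univ ^ (1 / 2 : ℝ) := by
  rw [← eLpNorm_one_eq_lintegral_enorm]
  refine (eLpNorm_le_eLpNorm_mul_rpow_measure_univ (p := 1) (q := 2) (by norm_num) hf).trans
    (le_of_eq ?_)
  congr 2
  norm_num

/-- Near each face, the deviation from the trace is controlled by the normal derivative. -/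
theorem HasWeakGradient.exists_trace (hT : ∀ i, 0 < T i) {u : (Fin p → ℝ) → E n}
    {v : (Fin p → ℝ) → J p n} (hu : MemLp u 2 (boxMeasure T)) (hv : MemLp v 2 (boxMeasure T))
    (h : HasWeakGradient T u v) (i : Fin p) :
    ∃ γ : ({j : Fin p // j ≠ i} → ℝ) → E n, MemLp γ 2 (volume.restrict (face T i)) ∧
      ∀ c, (c = 0 ∨ c = T i) → ∀ r, 0 ≤ r →
        ∫⁻ t in box T ∩ {t | |t i - c| ≤ r}, ‖u t - γ (fun j => t j)‖ₑ
          ≤ ENNReal.ofReal r * ∫⁻ t in box T ∩ {t | |t i - c| ≤ r}, ‖v t i‖ₑ := by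
  have hfin := isFiniteMeasure_boxMeasure T
  have hfinf : IsFiniteMeasure (volume.restrict (face T i)) :=
    ⟨by simpa using (isCompact_Icc (a := (0 : {j : Fin p // j ≠ i} → ℝ))
      (b := fun j : {j : Fin p // j ≠ i} => T j)).measure_lt_top⟩
  obtain ⟨D, hD, hDf⟩ := exists_eLpNorm_face_le hT n i
  set ε : ℕ → ℝ≥0∞ := fun N => ENNReal.ofReal (1 / ((N : ℝ) + 1)) with hε
  have hεpos : ∀ N, 0 < ε N := fun N => ENNReal.ofReal_pos.2 (by positivity)
  have hε0 : Tendsto ε atTop (𝓝 0) := by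
    simpa [hε] using ENNReal.tendsto_ofReal tendsto_one_div_add_atTop_nhds_zero_nat
  have hεmono : ∀ M N, M ≤ N → ε N ≤ ε M := fun M N hMN =>
    ENNReal.ofReal_le_ofReal (one_div_le_one_div_of_le (by positivity)
      (by have : (M : ℝ) ≤ N := by exact_mod_cast hMN
          linarith))
  choose f hf hfu hfv using fun N => exists_isPeriodicTest_near hT hu hv h (hεpos N)
  have hf1 : ∀ N, ContDiff ℝ 1 (f N) := fun N => (hf N).smooth.of_le (by simp)
  have hcg : ∀ N, Continuous fun t' => f N (glue i t' 0) := fun N =>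
    (hf N).smooth.continuous.comp ((continuous_glue i).comp (continuous_id.prodMk continuous_const))
  have hg : ∀ N, MemLp (fun t' => f N (glue i t' 0)) 2 (volume.restrict (face T i)) := fun N => by
    obtain ⟨C, hC⟩ := (isCompact_Icc (a := (0 : {j : Fin p // j ≠ i} → ℝ))
      (b := fun j : {j : Fin p // j ≠ i} => T j)).exists_bound_of_continuousOn (hcg N).continuousOn
    exact MemLp.of_bound (hcg N).aestronglyMeasurable C
      ((ae_restrict_iff' measurableSet_Icc).2 (Eventually.of_forall hC))
  -- The trace inequality applied to `f N - f M` makes the face values of the approximants Cauchy in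
  -- `L²`; their limit is the trace.
  have hcauchy : CauchySeq fun N => (hg N).toLp _ := by
    have hlim : Tendsto (fun N => (D * (2 * ε N)).toReal) atTop (𝓝 0) := by
      have h1 : Tendsto (fun N => D * (2 * ε N)) atTop (𝓝 (D * (2 * 0))) :=
        ENNReal.Tendsto.const_mul (ENNReal.Tendsto.const_mul hε0 (by simp)) (by simp [hD])
      rw [mul_zero, mul_zero] at h1
      exact (ENNReal.tendsto_toReal ENNReal.zero_ne_top).comp h1
    have hbound : ∀ N M, N ≤ M →
        dist ((hg N).toLp _) ((hg M).toLp _) ≤ (D * (2 * ε N)).toReal := fun N M hNM => by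
      rw [Lp.dist_def]
      refine ENNReal.toReal_mono (by finiteness) ?_
      have e1 : eLpNorm (((hg N).toLp _ : _ → E n) - ((hg M).toLp _ : _ → E n)) 2
          (volume.restrict (face T i))
          = eLpNorm (fun t' => (fun t => f N t - f M t) (glue i t' 0)) 2
            (volume.restrict (face T i)) :=
        eLpNorm_congr_ae ((hg N).coeFn_toLp.sub (hg M).coeFn_toLp)
      rw [e1]
      have tri : ∀ {a b c : (Fin p → ℝ) → E n} {x y : ℝ≥0∞},
          AEStronglyMeasurable a (boxMeasure T) → AEStronglyMeasurable b (boxMeasure T) →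
          AEStronglyMeasurable c (boxMeasure T) →
          eLpNorm (fun t => a t - c t) 2 (boxMeasure T) ≤ x →
          eLpNorm (fun t => b t - c t) 2 (boxMeasure T) ≤ y →
          eLpNorm (fun t => a t - b t) 2 (boxMeasure T) ≤ x + y := by
        intro a b c x y ha hb hc hx hy
        have e : (fun t => a t - b t) = (fun t => a t - c t) - fun t => b t - c t := by
          funext t
          simp
        rw [e]
        exact (eLpNorm_sub_le (ha.sub hc) (hb.sub hc) (by norm_num)).trans (add_le_add hx hy)
      have hle : ε N + ε M ≤ 2 * ε N := by
        rw [two_mul]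
        exact add_le_add_right (hεmono N M hNM) _
      refine hDf _ ((hf1 N).sub (hf1 M)) _ ((tri (hf N).smooth.continuous.aestronglyMeasurable
        (hf M).smooth.continuous.aestronglyMeasurable hu.1 (hfu N) (hfu M)).trans hle) ?_
      have e2 : pderiv i (fun t => f N t - f M t) = fun t => pderiv i (f N) t - pderiv i (f M) t := by
        funext t
        simp only [pderiv]
        rw [fderiv_fun_sub ((hf N).differentiable t) ((hf M).differentiable t)]
        rfl
      rw [e2]
      exact (tri ((hf N).continuous_pderiv i).aestronglyMeasurable
        ((hf M).continuous_pderiv i).aestronglyMeasurable (hv.eval_piLp i).1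
        (hfv N i) (hfv M i)).trans hle
    refine cauchySeq_of_le_tendsto_0 (fun N => 2 * (D * (2 * ε N)).toReal) (fun N M K hN hM => ?_)
      (by simpa using hlim.const_mul 2)
    have := dist_triangle_left ((hg N).toLp _) ((hg M).toLp _) ((hg K).toLp _)
    linarith [hbound K N hN, hbound K M hM]
  obtain ⟨G, hG⟩ := cauchySeq_tendsto_of_complete hcauchy
  rw [Lp.tendsto_Lp_iff_tendsto_eLpNorm'] at hG
  have hG' : Tendsto (fun N => eLpNorm (fun t' => f N (glue i t' 0) - G t') 2
      (volume.restrict (face T i))) atTop (𝓝 0) := by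
    refine hG.congr fun N => eLpNorm_congr_ae ?_
    filter_upwards [(hg N).coeFn_toLp] with t' ht'
    simp [ht']
  have hGm : StronglyMeasurable (G : ({j : Fin p // j ≠ i} → ℝ) → E n) := Lp.stronglyMeasurable G
  refine ⟨G, Lp.memLp G, fun c hc r hr => ?_⟩
  set B := box T ∩ {t | |t i - c| ≤ r} with hB
  have hBsub : B ⊆ box T := Set.inter_subset_left
  -- Periodicity of the approximants is what lets one `γ` serve both faces.
  have hper : ∀ N t', f N (glue i t' c) = f N (glue i t' 0) := fun N t' => by
    rcases hc with rfl | rfl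
    · rfl
    · rw [glue_eq_add, (hf N).periodic]
  set V := boxMeasure T Set.univ ^ (1 / 2 : ℝ) with hV
  have hVt : V ≠ ⊤ := ENNReal.rpow_ne_top_of_nonneg (by norm_num) (measure_ne_top _ _)
  set W := volume.restrict (face T i) Set.univ ^ (1 / 2 : ℝ) with hW
  have hWt : W ≠ ⊤ := ENNReal.rpow_ne_top_of_nonneg (by norm_num) (measure_ne_top _ _)
  -- The deviation `u - γ` splits into `u - f N`, `f N` minus its face value, and the face value
  -- minus `γ`. The outer two vanish in the limit; the middle one is controlled by the normal
  -- derivative over the slab.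
  have b1 : ∀ N, ∫⁻ t in B, ‖f N t - u t‖ₑ ≤ ε N * V := fun N =>
    (lintegral_mono_set hBsub).trans ((lintegral_enorm_le_eLpNorm_two
      ((hf N).smooth.continuous.aestronglyMeasurable.sub hu.1)).trans
        (mul_le_mul_left (hfu N) _))
  have b2 : ∀ N, ∫⁻ t in B, ‖pderiv i (f N) t - v t i‖ₑ ≤ ε N * V := fun N =>
    (lintegral_mono_set hBsub).trans ((lintegral_enorm_le_eLpNorm_two
      (((hf N).continuous_pderiv i).aestronglyMeasurable.sub (hv.eval_piLp i).1)).trans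
        (mul_le_mul_left (hfv N i) _))
  have b3 : ∀ N, ∫⁻ t in B, ‖f N (glue i (fun j => t j) 0) - G (fun j => t j)‖ₑ
      ≤ ENNReal.ofReal (T i) * (eLpNorm (fun t' => f N (glue i t' 0) - G t') 2
        (volume.restrict (face T i)) * W) := fun N => by
    refine (lintegral_mono_set hBsub).trans ?_
    have hm : Measurable fun t' => ‖f N (glue i t' 0) - G t'‖ₑ :=
      ((hcg N).measurable.sub hGm.measurable).enorm
    have hb : box T = box T ∩ {t | t i ∈ Set.univ} := by simp
    rw [hb, lintegral_slab T i Set.univ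
      (f := fun t => ‖f N (glue i (fun j => t j) 0) - G (fun j => t j)‖ₑ)
      (hm.comp (measurable_pi_lambda _ fun j => measurable_pi_apply (j : Fin p)))]
    simp only [glue_coe, setLIntegral_const, Set.inter_univ, Real.volume_Icc, sub_zero]
    rw [lintegral_mul_const _ hm, mul_comm]
    exact mul_le_mul_right (lintegral_enorm_le_eLpNorm_two
      ((hcg N).aestronglyMeasurable.sub hGm.aestronglyMeasurable)) _
  have b4 : ∀ N, ∫⁻ t in B, ‖f N t - f N (glue i (fun j => t j) c)‖ₑ
      ≤ ENNReal.ofReal r * ((∫⁻ t in B, ‖v t i‖ₑ) + ε N * V) := fun N => by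
    refine (lintegral_slab_sub_le hT (hf1 N) i hc hr).trans (mul_le_mul_right ?_ _)
    calc ∫⁻ t in B, ‖pderiv i (f N) t‖ₑ
        ≤ ∫⁻ t in B, (‖v t i‖ₑ + ‖pderiv i (f N) t - v t i‖ₑ) := by
          refine lintegral_mono fun t => ?_
          have := enorm_add_le (v t i) (pderiv i (f N) t - v t i)
          rwa [add_sub_cancel] at this
      _ = (∫⁻ t in B, ‖v t i‖ₑ) + ∫⁻ t in B, ‖pderiv i (f N) t - v t i‖ₑ :=
          lintegral_add_left'
            (((hv.eval_piLp i).1.mono_measure (Measure.restrict_mono hBsub le_rfl)).enorm) _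
      _ ≤ _ := add_le_add_right (b2 N) _
  have hlim : Tendsto (fun N => ε N * V
      + (ENNReal.ofReal r * ((∫⁻ t in B, ‖v t i‖ₑ) + ε N * V)
        + ENNReal.ofReal (T i) * (eLpNorm (fun t' => f N (glue i t' 0) - G t') 2
        (volume.restrict (face T i)) * W))) atTop
      (𝓝 (0 * V + (ENNReal.ofReal r * ((∫⁻ t in B, ‖v t i‖ₑ) + 0 * V)
        + ENNReal.ofReal (T i) * (0 * W)))) := by
    have l1 : Tendsto (fun N => ε N * V) atTop (𝓝 (0 * V)) :=
      ENNReal.Tendsto.mul_const hε0 (Or.inr hVt)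
    refine l1.add (Tendsto.add ?_ ?_)
    · exact ENNReal.Tendsto.const_mul (tendsto_const_nhds.add l1) (Or.inr ENNReal.ofReal_ne_top)
    · exact ENNReal.Tendsto.const_mul (ENNReal.Tendsto.mul_const hG' (Or.inr hWt))
        (Or.inr ENNReal.ofReal_ne_top)
  simp only [zero_mul, mul_zero, add_zero, zero_add] at hlim
  refine ge_of_tendsto' hlim fun N => ?_
  have hm1 : AEMeasurable (fun t => ‖f N t - u t‖ₑ) (volume.restrict B) :=
    (((hf N).smooth.continuous.aestronglyMeasurable.sub hu.1).mono_measure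
      (Measure.restrict_mono hBsub le_rfl)).enorm
  have hm2 : Measurable fun t : Fin p → ℝ => ‖f N t - f N (glue i (fun j => t j) c)‖ₑ := by
    simp only [hper]
    exact ((hf N).smooth.continuous.measurable.sub ((hcg N).measurable.comp
      (measurable_pi_lambda _ fun j => measurable_pi_apply (j : Fin p)))).enorm
  calc ∫⁻ t in B, ‖u t - G (fun j => t j)‖ₑ
      ≤ ∫⁻ t in B, (‖f N t - u t‖ₑ + (‖f N t - f N (glue i (fun j => t j) c)‖ₑ
          + ‖f N (glue i (fun j => t j) 0) - G (fun j => t j)‖ₑ)) := by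
        refine lintegral_mono fun t => ?_
        rw [hper, ← enorm_neg (f N t - u t)]
        refine le_trans (le_of_eq ?_) ((enorm_add_le _ _).trans
          (add_le_add_right (enorm_add_le _ _) _))
        congr 1
        abel
    _ = (∫⁻ t in B, ‖f N t - u t‖ₑ) + ((∫⁻ t in B, ‖f N t - f N (glue i (fun j => t j) c)‖ₑ)
          + ∫⁻ t in B, ‖f N (glue i (fun j => t j) 0) - G (fun j => t j)‖ₑ) := by
        rw [lintegral_add_left' hm1, lintegral_add_left hm2]
    _ ≤ _ := add_le_add (b1 N) (add_le_add (b4 N) (b3 N))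

theorem tendsto_volume_slab (T : Fin p → ℝ) (i : Fin p) {c : ℝ} (hc : c = 0 ∨ c = T i) :
    Tendsto (fun r : ℝ => volume (box T ∩ {t | |t i - c| ≤ r})) (𝓝[>] 0) (𝓝 0) := by
  have hle : ∀ r : ℝ, volume (box T ∩ {t | |t i - c| ≤ r})
      ≤ ENNReal.ofReal r * volume (face T i) := fun r => by
    have h1 := lintegral_slab T i {s | |s - c| ≤ r} (f := fun _ => 1) measurable_const
    simp only [setLIntegral_const, one_mul] at h1
    refine h1.le.trans ?_
    gcongr
    exact volume_Icc_inter_le hc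
  have hlim : Tendsto (fun r : ℝ => ENNReal.ofReal r * volume (face T i)) (𝓝[>] 0) (𝓝 0) := by
    have h1 : Tendsto (fun r : ℝ => ENNReal.ofReal r) (𝓝[>] 0) (𝓝 0) := by
      have := ENNReal.continuous_ofReal.tendsto 0
      rw [ENNReal.ofReal_zero] at this
      exact this.mono_left nhdsWithin_le_nhds
    have := ENNReal.Tendsto.mul_const (b := volume (face T i)) h1
      (Or.inr (isCompact_Icc.measure_lt_top).ne)
    rwa [zero_mul] at this
  exact tendsto_of_tendsto_of_tendsto_of_le_of_le tendsto_const_nhds hlim (fun _ => zero_le) hle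

/-- Periodic Sobolev functions have coinciding traces on opposite faces. -/
theorem HasWeakGradient.equalOnOppositeFaces (hT : ∀ i, 0 < T i) {u : (Fin p → ℝ) → E n}
    {v : (Fin p → ℝ) → J p n} (hu : MemLp u 2 (boxMeasure T)) (hv : MemLp v 2 (boxMeasure T))
    (h : HasWeakGradient T u v) : EqualOnOppositeFaces T u := by
  intro i
  have hfin := isFiniteMeasure_boxMeasure T
  obtain ⟨γ, hγ, hb⟩ := h.exists_trace hT hu hv i
  have main : ∀ c, (c = 0 ∨ c = T i) → HasFaceTrace T i c u γ := fun c hc => by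
    refine ⟨hγ, ?_⟩
    have hint : ∫⁻ t in box T, ‖v t i‖ₑ ≠ ⊤ :=
      ((hv.eval_piLp i).integrable (by norm_num)).2.ne
    have hS : ∀ r : ℝ, MeasurableSet {t : Fin p → ℝ | |t i - c| ≤ r} := fun r =>
      measurableSet_le (by fun_prop) measurable_const
    -- Division by `r` cancels the factor in the trace estimate and leaves the integral of `|v_i|`
    -- over a shrinking slab, which vanishes by absolute continuity.
    have hlim : Tendsto (fun r : ℝ => ∫⁻ t in box T ∩ {t | |t i - c| ≤ r}, ‖v t i‖ₑ)
        (𝓝[>] 0) (𝓝 0) := by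
      have := tendsto_setLIntegral_zero (μ := boxMeasure T) hint
        (l := 𝓝[>] (0 : ℝ)) (s := fun r => {t : Fin p → ℝ | |t i - c| ≤ r}) (by
          refine (tendsto_volume_slab T i hc).congr fun r => ?_
          rw [Function.comp_apply, Measure.restrict_apply (hS r), Set.inter_comm])
      refine this.congr fun r => ?_
      rw [Measure.restrict_restrict (hS r), Set.inter_comm]
    refine tendsto_of_tendsto_of_tendsto_of_le_of_le' tendsto_const_nhds hlim
      (Eventually.of_forall fun _ => zero_le) ?_
    filter_upwards [self_mem_nhdsWithin] with r hr
    refine ENNReal.div_le_of_le_mul ?_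
    rw [mul_comm]
    exact hb c hc r (le_of_lt hr)
  exact ⟨γ, main 0 (Or.inl rfl), main (T i) (Or.inr rfl)⟩

end PoissonGradient

end

/-! ### The direct method. -/

noncomputable section

namespace PoissonGradient

open scoped ENNReal

/-- Bounded sequences in a separable Hilbert space have weakly convergent subsequences. -/
theorem exists_weaklyConverges_subseq {H : Type*} [NormedAddCommGroup H] [InnerProductSpace ℝ H]
    [CompleteSpace H] [TopologicalSpace.SeparableSpace H] {x : ℕ → H} {R : ℝ}
    (hx : ∀ k, ‖x k‖ ≤ R) :
    ∃ (u : H) (φ : ℕ → ℕ), StrictMono φ ∧ WeaklyConverges (x ∘ φ) u := by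
  -- Sequential Banach–Alaoglu in the dual, transported by the Riesz isomorphism.
  obtain ⟨a, _, φ, hφ, hlim⟩ := WeakDual.isSeqCompact_closedBall ℝ H (0 : StrongDual ℝ H) R
    (x := fun k => StrongDual.toWeakDual (InnerProductSpace.toDual ℝ H (x k))) (fun k => by
      rw [Set.mem_preimage, mem_closedBall_zero_iff]
      exact ((InnerProductSpace.toDual ℝ H).norm_map (x k)).trans_le (hx k))
  refine ⟨(InnerProductSpace.toDual ℝ H).symm (WeakDual.toStrongDual a), φ, hφ, fun l => ?_⟩
  set y := (InnerProductSpace.toDual ℝ H).symm l with hy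
  have hl : ∀ z, l z = inner ℝ z y := fun z => by
    rw [real_inner_comm, hy, InnerProductSpace.toDual_symm_apply]
  have h := ((WeakDual.eval_continuous y).tendsto a).comp hlim
  simp only [hl, InnerProductSpace.toDual_symm_apply]
  exact h

variable {p n : ℕ} {T : Fin p → ℝ}

theorem norm_sq_eq_integral {α V : Type*} [MeasurableSpace α] {μ : Measure α}
    [NormedAddCommGroup V] [InnerProductSpace ℝ V] (f : Lp V 2 μ) :
    ‖f‖ ^ 2 = ∫ t, ‖f t‖ ^ 2 ∂μ := by
  rw [← real_inner_self_eq_norm_sq, L2.inner_def]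
  simp only [real_inner_self_eq_norm_sq]

/-- Both sides of each defining identity are inner products with a fixed `L²` class, hence
continuous in the pair. Completeness of `H¹_T` follows. -/
theorem isClosed_H1T (n : ℕ) (T : Fin p → ℝ) : IsClosed (H1T n T : Set (PairSpace n T)) := by
  have h : (H1T n T : Set (PairSpace n T)) = ⋂ (f : (Fin p → ℝ) → E n) (_ : IsPeriodicTest T f)
      (α : Fin p), {x | ∫ t in box T, inner ℝ (x.fst t) (pderiv α f t)
        = - ∫ t in box T, inner ℝ (x.snd t α) (f t)} := by
    ext x
    simp only [Set.mem_iInter]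
    rfl
  rw [h]
  refine isClosed_iInter fun f => isClosed_iInter fun hf => isClosed_iInter fun α =>
    isClosed_eq ?_ (Continuous.neg ?_)
  · have hm := memLp_of_continuous (T := T) (hf.continuous_pderiv α) 2
    have e : (fun x : PairSpace n T => ∫ t in box T, inner ℝ (x.fst t) (pderiv α f t))
        = fun x => inner ℝ x.fst (hm.toLp _) := by
      funext x
      rw [L2.inner_def]
      refine integral_congr_ae ?_
      filter_upwards [hm.coeFn_toLp] with t ht
      rw [ht]
    rw [e]
    exact (WithLp.fstL 2 ℝ _ _).continuous.inner continuous_const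
  · have hm := memLp_of_continuous (T := T) hf.smooth.continuous 2
    have e : (fun x : PairSpace n T => ∫ t in box T, inner ℝ (x.snd t α) (f t))
        = fun x => inner ℝ ((PiLp.proj (𝕜 := ℝ) 2 (fun _ : Fin p => E n) α).compLpL 2
          (boxMeasure T) x.snd) (hm.toLp _) := by
      funext x
      rw [L2.inner_def]
      refine integral_congr_ae ?_
      filter_upwards [hm.coeFn_toLp, ContinuousLinearMap.coeFn_compLpL
        (PiLp.proj (𝕜 := ℝ) 2 (fun _ : Fin p => E n) α) x.snd] with t ht ht2
      rw [ht, ht2]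
      rfl
    rw [e]
    exact ((ContinuousLinearMap.continuous _).comp (WithLp.sndL 2 ℝ _ _).continuous).inner
      continuous_const

theorem completeSpace_H1T (n : ℕ) (T : Fin p → ℝ) : CompleteSpace (H1T n T) :=
  (isClosed_H1T n T).completeSpace_coe

theorem separableSpace_H1T (n : ℕ) (T : Fin p → ℝ) :
    TopologicalSpace.SeparableSpace (H1T n T) := by
  have : Fact ((2 : ℝ≥0∞) ≠ ⊤) := ⟨by norm_num⟩
  have h1 : SecondCountableTopology (Lp (E n) 2 (boxMeasure T)) := inferInstance
  have h2 : SecondCountableTopology (Lp (J p n) 2 (boxMeasure T)) := inferInstance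
  have h : SecondCountableTopology (PairSpace n T) :=
    (WithLp.homeomorphProd 2 _ _).secondCountableTopology
  infer_instance

theorem norm_sq_H1T (u : H1T n T) : ‖u‖ ^ 2 = ‖u.1.fst‖ ^ 2 + ‖u.1.snd‖ ^ 2 :=
  WithLp.prod_norm_sq_eq_of_L2 u.1

/-- A Carathéodory function composed with a measurable function is measurable. -/
theorem aestronglyMeasurable_caratheodory {α V : Type*} [MeasurableSpace α] {μ : Measure α}
    [NormedAddCommGroup V] {F : α → V → ℝ} (hF : ∀ x, AEMeasurable (fun t => F t x) μ)
    (hc : ∀ᵐ t ∂μ, Continuous (F t)) {u : α → V} (hu : AEStronglyMeasurable u μ) :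
    AEStronglyMeasurable (fun t => F t (u t)) μ := by
  have hs : ∀ s : SimpleFunc α V, AEMeasurable (fun t => F t (s t)) μ := fun s => by
    classical
    have e : (fun t => F t (s t))
        = fun t => ∑ x ∈ s.range, (s ⁻¹' {x}).indicator (fun t => F t x) t := by
      funext t
      rw [Finset.sum_eq_single (s t)]
      · simp
      · intro x _ hx
        exact Set.indicator_of_notMem (fun h => hx h.symm) _
      · exact fun h => absurd (s.mem_range_self t) h
    rw [e]
    exact Finset.aemeasurable_fun_sum _ fun x _ => (hF x).indicator (s.measurableSet_fiber x)
  -- Simple functions reduce to finitely many constants; continuity in the second variable then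
  -- passes to the limit of simple approximations.
  refine aestronglyMeasurable_of_tendsto_ae atTop
    (f := fun k t => F t (hu.stronglyMeasurable_mk.approx k t))
    (fun k => (hs _).aestronglyMeasurable) ?_
  filter_upwards [hc, hu.ae_eq_mk] with t ht hut
  rw [hut]
  exact (ht.tendsto _).comp (hu.stronglyMeasurable_mk.tendsto_approx t)

/-- The properties of the potential which make its action finite: it is Lipschitz in the field,
uniformly over the parallelepiped, and bounded at the origin. -/
structure IsLipschitzPotential (T : Fin p → ℝ) (F : (Fin p → ℝ) → E n → ℝ) (L M : ℝ) : Prop where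
  meas : ∀ x : E n, AEMeasurable (fun t => F t x) (boxMeasure T)
  lip : ∀ t ∈ box T, ∀ x y : E n, |F t x - F t y| ≤ L * ‖x - y‖
  bdd : ∀ t ∈ box T, |F t 0| ≤ M
  nonneg : 0 ≤ L

namespace IsLipschitzPotential

variable {F : (Fin p → ℝ) → E n → ℝ} {L M : ℝ}

theorem continuous (hF : IsLipschitzPotential T F L M) {t : Fin p → ℝ} (ht : t ∈ box T) :
    Continuous (F t) := by
  refine (LipschitzWith.of_dist_le_mul (K := ⟨L, hF.nonneg⟩) fun x y => ?_).continuous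
  rw [Real.dist_eq, dist_eq_norm]
  exact hF.lip t ht x y

theorem ae_mem_box (T : Fin p → ℝ) : ∀ᵐ t ∂boxMeasure T, t ∈ box T :=
  ae_restrict_mem measurableSet_Icc

theorem aestronglyMeasurable (hF : IsLipschitzPotential T F L M) {u : (Fin p → ℝ) → E n}
    (hu : AEStronglyMeasurable u (boxMeasure T)) :
    AEStronglyMeasurable (fun t => F t (u t)) (boxMeasure T) :=
  aestronglyMeasurable_caratheodory hF.meas
    ((ae_mem_box T).mono fun _ ht => hF.continuous ht) hu

theorem abs_le (hF : IsLipschitzPotential T F L M) {t : Fin p → ℝ} (ht : t ∈ box T) (x : E n) :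
    |F t x| ≤ L * ‖x‖ + M := by
  have h1 := hF.lip t ht x 0
  rw [sub_zero] at h1
  have h2 := abs_add_le (F t x - F t 0) (F t 0)
  rw [sub_add_cancel] at h2
  linarith [hF.bdd t ht]

theorem integrable (hF : IsLipschitzPotential T F L M) {u : (Fin p → ℝ) → E n}
    (hu : MemLp u 2 (boxMeasure T)) : Integrable (fun t => F t (u t)) (boxMeasure T) := by
  have := isFiniteMeasure_boxMeasure T
  refine Integrable.mono' (((hu.integrable (by norm_num)).norm.const_mul L).add
    (integrable_const M)) (hF.aestronglyMeasurable hu.1) ?_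
  filter_upwards [ae_mem_box T] with t ht
  exact hF.abs_le ht (u t)

theorem action_eq (hF : IsLipschitzPotential T F L M) (u : H1T n T) :
    action F u = 1 / 2 * ‖u.1.snd‖ ^ 2 + potentialAction F u := by
  have hi : Integrable (fun t => 1 / 2 * ‖weakGrad u t‖ ^ 2) (boxMeasure T) :=
    ((Lp.memLp u.1.snd).integrable_norm_pow (by norm_num)).const_mul _
  have hi2 : Integrable (fun t => F t (field u t)) (boxMeasure T) :=
    hF.integrable (Lp.memLp u.1.fst)
  rw [action, potentialAction, integral_add hi hi2,
    integral_const_mul, norm_sq_eq_integral]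
  rfl

/-- The mean value of a field. -/
def mean (u : H1T n T) : E n := ∫ s, field u s ∂boxProb T

theorem integral_norm_sub_mean_sq_le (hT : ∀ i, 0 < T i) (u : H1T n T) :
    ∫ t in box T, ‖field u t - mean u‖ ^ 2
      ≤ (∑ α, (T α / (2 * Real.pi)) ^ 2) * ‖u.1.snd‖ ^ 2 := by
  rw [norm_sq_eq_integral]
  exact HasWeakGradient.setIntegral_norm_sq_sub_mean_le hT (Lp.memLp u.1.fst) (Lp.memLp u.1.snd)
    u.2

theorem memLp_sub_mean (u : H1T n T) :
    MemLp (fun t => field u t - mean u) 2 (boxMeasure T) := by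
  have := isFiniteMeasure_boxMeasure T
  exact (Lp.memLp u.1.fst).sub (memLp_const _)

/-- The Lipschitz bound compares the potential at `u` and at its mean; Young's inequality and
Poincaré–Wirtinger pay for the difference with half of the kinetic energy. -/
theorem exists_le_action (hF : IsLipschitzPotential T F L M) (hT : ∀ i, 0 < T i) :
    ∃ K : ℝ, ∀ u : H1T n T,
      1 / 4 * ‖u.1.snd‖ ^ 2 + (∫ t in box T, F t (mean u)) - K ≤ action F u := by
  have := isFiniteMeasure_boxMeasure T
  set C := (∑ α, (T α / (2 * Real.pi)) ^ 2) with hC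
  have hC0 : 0 ≤ C := Finset.sum_nonneg fun _ _ => sq_nonneg _
  -- The constant comes from `L s ≤ s² / (4 (C + 1)) + L² (C + 1)`. The weight `C + 1` is never zero
  -- and beats the Poincaré constant `C`.
  refine ⟨∫ _t in box T, L ^ 2 * (C + 1), fun u => ?_⟩
  rw [hF.action_eq u]
  have hi1 : Integrable (fun t => F t (mean u)) (boxMeasure T) := hF.integrable (memLp_const _)
  have hi2 : Integrable (fun t => 1 / (4 * (C + 1)) * ‖field u t - mean u‖ ^ 2) (boxMeasure T) :=
    ((memLp_sub_mean u).integrable_norm_pow (by norm_num)).const_mul _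
  have h1 : (∫ t in box T, F t (mean u))
      - (∫ t in box T, 1 / (4 * (C + 1)) * ‖field u t - mean u‖ ^ 2)
      - (∫ _t in box T, L ^ 2 * (C + 1)) ≤ potentialAction F u := by
    have hi3 : Integrable (fun t => F t (mean u)
        - 1 / (4 * (C + 1)) * ‖field u t - mean u‖ ^ 2) (boxMeasure T) := hi1.sub hi2
    rw [← integral_sub hi1 hi2, ← integral_sub hi3 (integrable_const _)]
    refine integral_mono_ae (hi3.sub (integrable_const _))
      (hF.integrable (Lp.memLp u.1.fst)) ?_
    filter_upwards [ae_mem_box T] with t ht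
    have h2 := (_root_.abs_le.1 (hF.lip t ht (field u t) (mean u))).1
    set s := ‖field u t - mean u‖
    have h3 : L * s ≤ 1 / (4 * (C + 1)) * s ^ 2 + L ^ 2 * (C + 1) := by
      have h4 : 1 / (4 * (C + 1)) * s ^ 2 + L ^ 2 * (C + 1) - L * s
          = (s - 2 * (C + 1) * L) ^ 2 / (4 * (C + 1)) := by
        field_simp
        ring
      have h5 : 0 ≤ (s - 2 * (C + 1) * L) ^ 2 / (4 * (C + 1)) := by positivity
      linarith
    change F t (mean u) - _ - _ ≤ F t (field u t)
    linarith
  have h6 : ∫ t in box T, 1 / (4 * (C + 1)) * ‖field u t - mean u‖ ^ 2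
      ≤ 1 / 4 * ‖u.1.snd‖ ^ 2 := by
    rw [integral_const_mul]
    have h7 := integral_norm_sub_mean_sq_le hT u
    calc 1 / (4 * (C + 1)) * ∫ t in box T, ‖field u t - mean u‖ ^ 2
        ≤ 1 / (4 * (C + 1)) * (C * ‖u.1.snd‖ ^ 2) := by gcongr
      _ ≤ 1 / (4 * (C + 1)) * ((C + 1) * ‖u.1.snd‖ ^ 2) := by gcongr; linarith
      _ = 1 / 4 * ‖u.1.snd‖ ^ 2 := by field_simp
  linarith

theorem norm_fst_sq_le (hT : ∀ i, 0 < T i) (u : H1T n T) :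
    ‖u.1.fst‖ ^ 2 ≤ 2 * (∑ α, (T α / (2 * Real.pi)) ^ 2) * ‖u.1.snd‖ ^ 2
      + 2 * (boxMeasure T).real Set.univ * ‖mean u‖ ^ 2 := by
  have := isFiniteMeasure_boxMeasure T
  have hi := (memLp_sub_mean u).integrable_norm_pow (p := 2) (by norm_num)
  have h1 : ‖u.1.fst‖ ^ 2
      ≤ ∫ t in box T, (2 * ‖field u t - mean u‖ ^ 2 + 2 * ‖mean u‖ ^ 2) := by
    rw [norm_sq_eq_integral]
    refine integral_mono_ae ((Lp.memLp u.1.fst).integrable_norm_pow (by norm_num))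
      ((hi.const_mul 2).add (integrable_const _)) (Eventually.of_forall fun t => ?_)
    have h2 : ‖field u t‖ ≤ ‖field u t - mean u‖ + ‖mean u‖ := by
      simpa using norm_add_le (field u t - mean u) (mean u)
    change ‖field u t‖ ^ 2 ≤ 2 * ‖field u t - mean u‖ ^ 2 + 2 * ‖mean u‖ ^ 2
    nlinarith [sq_nonneg (‖field u t - mean u‖ - ‖mean u‖), norm_nonneg (field u t)]
  rw [integral_add (hi.const_mul 2) (integrable_const _), integral_const_mul, integral_const,
    smul_eq_mul] at h1
  have h3 := integral_norm_sub_mean_sq_le hT u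
  linarith

/-- The action is bounded below and coercive. -/
theorem exists_norm_le_of_action_le (hF : IsLipschitzPotential T F L M) (hT : ∀ i, 0 < T i)
    (hco : Tendsto (fun x : E n => ∫ t in box T, F t x) (Bornology.cobounded (E n)) atTop) :
    BddBelow (Set.range (action F : H1T n T → ℝ)) ∧
      ∀ c, ∃ R, ∀ u : H1T n T, action F u ≤ c → ‖u‖ ≤ R := by
  have := isFiniteMeasure_boxMeasure T
  obtain ⟨K, hK⟩ := hF.exists_le_action hT
  have hR : ∀ c, ∃ R, 0 ≤ R ∧ ∀ x : E n, ∫ t in box T, F t x < c → ‖x‖ ≤ R := fun c => by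
    have h2 : Bornology.IsBounded {x : E n | c ≤ ∫ t in box T, F t x}ᶜ :=
      Bornology.isBounded_def.2 (by
        rw [compl_compl]
        exact hco.eventually_ge_atTop c)
    obtain ⟨R, hR0, hR⟩ := h2.exists_pos_norm_le
    exact ⟨R, hR0.le, fun x hx => hR x (not_le.2 hx)⟩
  -- Negative values occur only inside a ball, by coercivity, and there the linear growth of `F`
  -- bounds the integral.
  have hm : ∃ m : ℝ, ∀ x : E n, -m ≤ ∫ t in box T, F t x := by
    obtain ⟨R, hR0, hR1⟩ := hR 0
    refine ⟨|∫ _t in box T, (L * R + M)|, fun x => ?_⟩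
    by_cases hx : ∫ t in box T, F t x < 0
    · have h1 : |∫ t in box T, F t x| ≤ ∫ _t in box T, (L * R + M) := by
        rw [← Real.norm_eq_abs]
        refine norm_integral_le_of_norm_le (integrable_const _) ?_
        filter_upwards [ae_mem_box T] with t ht
        refine (hF.abs_le ht x).trans ?_
        have := mul_le_mul_of_nonneg_left (hR1 x hx) hF.nonneg
        linarith
      have h2 := neg_abs_le (∫ t in box T, F t x)
      have h3 := le_abs_self (∫ _t in box T, (L * R + M))
      linarith
    · have := abs_nonneg (∫ _t in box T, (L * R + M))
      linarith
  obtain ⟨m, hm⟩ := hm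
  refine ⟨⟨-m - K, ?_⟩, fun c => ?_⟩
  · rintro _ ⟨u, rfl⟩
    nlinarith [hK u, hm (mean u), sq_nonneg ‖u.1.snd‖]
  -- The extra `1` gives the strict inequality that `hR` asks for.
  · obtain ⟨R, hR0, hR1⟩ := hR (c + K + 1)
    set C := (∑ α, (T α / (2 * Real.pi)) ^ 2) with hC
    have hC0 : 0 ≤ C := Finset.sum_nonneg fun _ _ => sq_nonneg _
    set D := (2 * C + 1) * (4 * (c + K + m)) + 2 * (boxMeasure T).real Set.univ * R ^ 2 with hD
    refine ⟨D + 1, fun u hu => ?_⟩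
    have h1 : ‖u.1.snd‖ ^ 2 ≤ 4 * (c + K + m) := by linarith [hK u, hm (mean u)]
    have h2 : ‖mean u‖ ≤ R := hR1 _ (by nlinarith [hK u, sq_nonneg ‖u.1.snd‖])
    have h3 : ‖mean u‖ ^ 2 ≤ R ^ 2 := pow_le_pow_left₀ (norm_nonneg _) h2 2
    have h4 : ‖u‖ ^ 2 ≤ D := by
      rw [norm_sq_H1T, hD]
      have h5 := norm_fst_sq_le hT u
      have h6 : 2 * (boxMeasure T).real Set.univ * ‖mean u‖ ^ 2
          ≤ 2 * (boxMeasure T).real Set.univ * R ^ 2 :=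
        mul_le_mul_of_nonneg_left h3 (by positivity)
      have h7 : (2 * C + 1) * ‖u.1.snd‖ ^ 2 ≤ (2 * C + 1) * (4 * (c + K + m)) :=
        mul_le_mul_of_nonneg_left h1 (by positivity)
      linarith
    -- `2 ‖u‖ ≤ ‖u‖² + 1` replaces a square root.
    nlinarith [sq_nonneg (‖u‖ - 1)]

/-- **Direct method**: the action attains its minimum. -/
theorem exists_isMinimizer (hF : IsLipschitzPotential T F L M) (hT : ∀ i, 0 < T i)
    (hco : Tendsto (fun x : E n => ∫ t in box T, F t x) (Bornology.cobounded (E n)) atTop)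
    (hwlsc : WeaklyLSC (fun u : H1T n T => potentialAction F u)) :
    ∃ u : H1T n T, ∀ w : H1T n T, action F u ≤ action F w := by
  have := completeSpace_H1T n T
  have := separableSpace_H1T n T
  obtain ⟨hbdd, hcoer⟩ := hF.exists_norm_le_of_action_le hT hco
  set m := sInf (Set.range (action F : H1T n T → ℝ)) with hm
  obtain ⟨y, hyanti, hylim, hymem⟩ := exists_seq_tendsto_sInf
    (Set.range_nonempty (action F : H1T n T → ℝ)) hbdd
  choose x hx using hymem
  obtain ⟨R, hR⟩ := hcoer (y 0)
  obtain ⟨u, φ, hφ, hu⟩ := exists_weaklyConverges_subseq (x := x) (R := R)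
    (fun k => hR _ ((hx k).trans_le (hyanti (Nat.zero_le k))))
  refine ⟨u, fun w => ?_⟩
  suffices h : action F u ≤ m from h.trans (csInf_le hbdd ⟨w, rfl⟩)
  -- Pairing with the fixed gradient of the limit is a bounded functional on `H¹_T`, so weak
  -- convergence applies.
  have hgrad : Tendsto (fun k => inner ℝ u.1.snd ((x (φ k)).1.snd)) atTop
      (𝓝 (inner ℝ u.1.snd u.1.snd)) :=
    hu ((innerSL ℝ u.1.snd).comp ((WithLp.sndL 2 ℝ _ _).comp (H1T n T).subtypeL))
  refine le_of_forall_pos_le_add fun ε hε => ?_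
  have hlow : ∀ᶠ k in atTop, potentialAction F u - ε ≤ potentialAction F (x (φ k)) := by
    have h1 : ((potentialAction F u - ε : ℝ) : EReal)
        < liminf (fun k => (potentialAction F ((x ∘ φ) k) : EReal)) atTop :=
      lt_of_lt_of_le (EReal.coe_lt_coe_iff.2 (by linarith)) (hwlsc _ _ hu)
    filter_upwards [eventually_lt_of_lt_liminf h1] with k hk
    exact (EReal.coe_lt_coe_iff.1 hk).le
  have hlimL : Tendsto (fun k => inner ℝ u.1.snd ((x (φ k)).1.snd) - 1 / 2 * ‖u.1.snd‖ ^ 2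
      + (potentialAction F u - ε)) atTop (𝓝 (inner ℝ u.1.snd u.1.snd - 1 / 2 * ‖u.1.snd‖ ^ 2
      + (potentialAction F u - ε))) := (hgrad.sub_const _).add_const _
  have hlimR : Tendsto (fun k => action F (x (φ k))) atTop (𝓝 m) := by
    refine (hylim.comp hφ.tendsto_atTop).congr fun k => ?_
    exact (hx (φ k)).symm
  -- Convexity: `½ |v_k|² ≥ (v, v_k) - ½ |v|²` bounds the action below by quantities that converge.
  have hle := le_of_tendsto_of_tendsto hlimL hlimR (by
    filter_upwards [hlow] with k hk
    rw [hF.action_eq]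
    have h1 := norm_sub_sq_real u.1.snd (x (φ k)).1.snd
    nlinarith [sq_nonneg ‖u.1.snd - (x (φ k)).1.snd‖])
  rw [real_inner_self_eq_norm_sq] at hle
  rw [hF.action_eq]
  linarith

end IsLipschitzPotential

end PoissonGradient

end

/-! ### The Euler–Lagrange equation. -/

noncomputable section

namespace PoissonGradient

open scoped ENNReal

variable {p n : ℕ} {T : Fin p → ℝ}

/-- The classical Jacobi matrix. -/
def jacobi (f : (Fin p → ℝ) → E n) (t : Fin p → ℝ) : J p n :=
  WithLp.toLp 2 fun α => pderiv α f t

theorem IsPeriodicTest.memLp {f : (Fin p → ℝ) → E n} (hf : IsPeriodicTest T f) :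
    MemLp f 2 (boxMeasure T) :=
  memLp_of_continuous hf.smooth.continuous 2

theorem IsPeriodicTest.memLp_jacobi {f : (Fin p → ℝ) → E n} (hf : IsPeriodicTest T f) :
    MemLp (jacobi f) 2 (boxMeasure T) :=
  MemLp.of_eval_piLp fun α => memLp_of_continuous (hf.continuous_pderiv α) 2

theorem HasWeakGradient.congr {u u' : (Fin p → ℝ) → E n} {v v' : (Fin p → ℝ) → J p n}
    (h : HasWeakGradient T u v) (hu : u' =ᵐ[boxMeasure T] u) (hv : v' =ᵐ[boxMeasure T] v) :
    HasWeakGradient T u' v' := by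
  intro f hf α
  have h1 : ∫ t in box T, inner ℝ (u' t) (pderiv α f t)
      = ∫ t in box T, inner ℝ (u t) (pderiv α f t) :=
    integral_congr_ae (by filter_upwards [hu] with t ht; rw [ht])
  have h2 : ∫ t in box T, inner ℝ (v' t α) (f t) = ∫ t in box T, inner ℝ (v t α) (f t) :=
    integral_congr_ae (by filter_upwards [hv] with t ht; rw [ht])
  rw [h1, h2]
  exact h f hf α

/-- Integration by parts: classical derivatives of test functions are weak derivatives. -/
theorem IsPeriodicTest.hasWeakGradient (hT : ∀ i, 0 < T i) {f : (Fin p → ℝ) → E n}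
    (hf : IsPeriodicTest T f) : HasWeakGradient T f (jacobi f) := by
  intro ψ hψ α
  have hs : ContDiff ℝ 1 fun t => (inner ℝ (f t) (ψ t) : ℝ) :=
    (hf.smooth.inner ℝ hψ.smooth).of_le (by simp)
  have h0 := setIntegral_fderiv_eq_zero hT hs α fun t => by rw [hf.periodic, hψ.periodic]
  have hd : ∀ t, fderiv ℝ (fun t => (inner ℝ (f t) (ψ t) : ℝ)) t (Pi.single α 1)
      = inner ℝ (f t) (pderiv α ψ t) + inner ℝ (pderiv α f t) (ψ t) := fun t =>
    fderiv_inner_apply ℝ (hf.differentiable t) (hψ.differentiable t) _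
  simp only [hd] at h0
  rw [integral_add (integrable_inner_continuous T hf.memLp (hψ.continuous_pderiv α))
    (integrable_inner_continuous T (memLp_of_continuous (hf.continuous_pderiv α) 2)
      hψ.smooth.continuous)] at h0
  exact eq_neg_of_add_eq_zero_left h0

/-- A test function as an element of `H¹_T`. -/
def IsPeriodicTest.toH1T (hT : ∀ i, 0 < T i) {f : (Fin p → ℝ) → E n} (hf : IsPeriodicTest T f) :
    H1T n T :=
  ⟨WithLp.toLp 2 (hf.memLp.toLp f, hf.memLp_jacobi.toLp (jacobi f)),
    (hf.hasWeakGradient hT).congr hf.memLp.coeFn_toLp hf.memLp_jacobi.coeFn_toLp⟩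

theorem inner_gradient_eq (f : E n → ℝ) (x y : E n) :
    inner ℝ (gradient f x) y = fderiv ℝ f x y :=
  InnerProductSpace.toDual_symm_apply

theorem norm_gradient_eq (f : E n → ℝ) (x : E n) : ‖gradient f x‖ = ‖fderiv ℝ f x‖ :=
  (InnerProductSpace.toDual ℝ (E n)).symm.norm_map _

theorem hasDerivAt_line {f : E n → ℝ} (hf : ContDiff ℝ 1 f) (x y : E n) :
    HasDerivAt (fun s : ℝ => f (x + s • y)) (inner ℝ (gradient f x) y) 0 := by
  rw [inner_gradient_eq]
  have h1 : HasDerivAt (fun s : ℝ => x + s • y) y 0 := by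
    simpa using ((hasDerivAt_id (0 : ℝ)).smul_const y).const_add x
  have h2 : HasFDerivAt f (fderiv ℝ f x) (x + (0 : ℝ) • y) := by
    rw [zero_smul, add_zero]
    exact (hf.differentiable one_ne_zero x).hasFDerivAt
  exact h2.comp_hasDerivAt 0 h1

namespace IsLipschitzPotential

variable {F : (Fin p → ℝ) → E n → ℝ} {L M : ℝ}

/-- Each component of the gradient is a limit of difference quotients of `F` with steps `1 / (k +
1)`, which are measurable by the Carathéodory property. -/
theorem aestronglyMeasurable_gradient (hF : IsLipschitzPotential T F L M)
    (hd : ∀ t ∈ box T, ContDiff ℝ 1 (F t)) {u : (Fin p → ℝ) → E n}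
    (hu : AEStronglyMeasurable u (boxMeasure T)) :
    AEStronglyMeasurable (fun t => gradient (F t) (u t)) (boxMeasure T) := by
  have hj : ∀ j, AEStronglyMeasurable (fun t => gradient (F t) (u t) j) (boxMeasure T) :=
      fun j => by
    set y : E n := EuclideanSpace.single j (1 : ℝ) with hy
    refine aestronglyMeasurable_of_tendsto_ae atTop
      (f := fun (k : ℕ) t => ((k : ℝ) + 1) * (F t (u t + (1 / ((k : ℝ) + 1)) • y) - F t (u t)))
      (fun k => ((hF.aestronglyMeasurable (hu.add_const _)).sub
        (hF.aestronglyMeasurable hu)).const_mul _) ?_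
    filter_upwards [ae_mem_box T] with t ht
    have h1 := (hasDerivAt_line (hd t ht) (u t) y).tendsto_slope_zero
    have h2 : Tendsto (fun k : ℕ => 1 / ((k : ℝ) + 1)) atTop (𝓝[≠] 0) :=
      tendsto_nhdsWithin_iff.2 ⟨tendsto_one_div_add_atTop_nhds_zero_nat,
        Eventually.of_forall fun k => by
          have : (0 : ℝ) < 1 / ((k : ℝ) + 1) := by positivity
          exact this.ne'⟩
    have h3 := h1.comp h2
    have h4 : inner ℝ (gradient (F t) (u t)) y = gradient (F t) (u t) j := by
      simpa using inner_smul_single (gradient (F t) (u t)) 1 j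
    rw [h4] at h3
    refine h3.congr fun k => ?_
    simp
  have h := (PiLp.continuous_toLp 2 fun _ : Fin n => ℝ).comp_aestronglyMeasurable
    (aemeasurable_pi_iff.2 fun j => (hj j).aemeasurable).aestronglyMeasurable
  exact h

theorem norm_gradient_le (hF : IsLipschitzPotential T F L M) {t : Fin p → ℝ} (ht : t ∈ box T)
    (x : E n) : ‖gradient (F t) x‖ ≤ L := by
  rw [norm_gradient_eq]
  refine norm_fderiv_le_of_lip' ℝ hF.nonneg (Eventually.of_forall fun y => ?_)
  exact hF.lip t ht y x

theorem memLp_gradient (hF : IsLipschitzPotential T F L M)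
    (hd : ∀ t ∈ box T, ContDiff ℝ 1 (F t)) {u : (Fin p → ℝ) → E n}
    (hu : AEStronglyMeasurable u (boxMeasure T)) :
    MemLp (fun t => gradient (F t) (u t)) 2 (boxMeasure T) := by
  have := isFiniteMeasure_boxMeasure T
  refine MemLp.of_bound (hF.aestronglyMeasurable_gradient hd hu) L ?_
  filter_upwards [ae_mem_box T] with t ht
  exact hF.norm_gradient_le ht _

/-- Differentiation under the integral: the integrand is Lipschitz in `s` with the integrable
constant `L ‖f t‖`. -/
theorem hasDerivAt_potential (hF : IsLipschitzPotential T F L M)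
    (hd : ∀ t ∈ box T, ContDiff ℝ 1 (F t)) {u f : (Fin p → ℝ) → E n}
    (hu : MemLp u 2 (boxMeasure T)) (hf : MemLp f 2 (boxMeasure T)) :
    HasDerivAt (fun s : ℝ => ∫ t in box T, F t (u t + s • f t))
      (∫ t in box T, inner ℝ (gradient (F t) (u t)) (f t)) 0 := by
  have := isFiniteMeasure_boxMeasure T
  have hm : ∀ s : ℝ, MemLp (fun t => u t + s • f t) 2 (boxMeasure T) := fun s =>
    hu.add (hf.const_smul s)
  refine (hasDerivAt_integral_of_dominated_loc_of_lip (μ := boxMeasure T)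
    (F := fun (s : ℝ) t => F t (u t + s • f t)) (bound := fun t => L * ‖f t‖) univ_mem
    (Eventually.of_forall fun s => hF.aestronglyMeasurable (hm s).1) (hF.integrable (hm 0))
    ((hF.aestronglyMeasurable_gradient hd hu.1).inner hf.1) ?_
    ((hf.integrable (by norm_num)).norm.const_mul L) ?_).2
  · filter_upwards [ae_mem_box T] with t ht
    refine LipschitzOnWith.of_dist_le_mul fun s _ s' _ => ?_
    rw [Real.dist_eq, Real.dist_eq, Real.coe_nnabs,
      abs_of_nonneg (mul_nonneg hF.nonneg (norm_nonneg _))]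
    refine (hF.lip t ht _ _).trans (le_of_eq ?_)
    rw [add_sub_add_left_eq_sub, ← sub_smul, norm_smul, Real.norm_eq_abs]
    ring
  · filter_upwards [ae_mem_box T] with t ht
    exact hasDerivAt_line (hd t ht) (u t) (f t)

/-- **Euler–Lagrange equation**: a minimizer of the action solves the Poisson-gradient equation. -/
theorem hasWeakLaplacian_of_isMinimizer (hF : IsLipschitzPotential T F L M)
    (hT : ∀ i, 0 < T i) (hd : ∀ t ∈ box T, ContDiff ℝ 1 (F t)) {u : H1T n T}
    (hmin : ∀ w : H1T n T, action F u ≤ action F w) :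
    HasWeakLaplacian u fun t => gradient (F t) (field u t) := by
  have hu : MemLp (field u) 2 (boxMeasure T) := Lp.memLp u.1.fst
  refine ⟨hF.memLp_gradient hd hu.1, fun f hf => ?_⟩
  set φ := hf.toH1T hT with hφ
  -- The kinetic part is a quadratic polynomial in `s`, whose linear coefficient is the weak form of
  -- the Laplacian.
  have hact : ∀ s : ℝ, action F (u + s • φ)
      = 1 / 2 * (‖u.1.snd‖ ^ 2 + 2 * (s * inner ℝ u.1.snd φ.1.snd) + s ^ 2 * ‖φ.1.snd‖ ^ 2)
        + ∫ t in box T, F t (field u t + s • f t) := fun s => by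
    rw [hF.action_eq]
    congr 1
    · change 1 / 2 * ‖u.1.snd + s • φ.1.snd‖ ^ 2 = _
      rw [norm_add_sq_real, real_inner_smul_right, norm_smul, mul_pow, Real.norm_eq_abs, sq_abs]
    · refine integral_congr_ae ?_
      have h1 : field (u + s • φ) =ᵐ[boxMeasure T] fun t => field u t + s • f t := by
        change ((u.1.fst + s • φ.1.fst : Lp (E n) 2 (boxMeasure T)) : (Fin p → ℝ) → E n)
          =ᵐ[boxMeasure T] _
        filter_upwards [Lp.coeFn_add u.1.fst (s • φ.1.fst), Lp.coeFn_smul s φ.1.fst,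
          hf.memLp.coeFn_toLp] with t h1 h2 h3
        rw [h1, Pi.add_apply, h2, Pi.smul_apply]
        exact congrArg (fun x => field u t + s • x) h3
      filter_upwards [h1] with t ht
      rw [ht]
  have hder : HasDerivAt (fun s : ℝ => action F (u + s • φ))
      (inner ℝ u.1.snd φ.1.snd + ∫ t in box T, inner ℝ (gradient (F t) (field u t)) (f t)) 0 := by
    simp only [hact]
    refine HasDerivAt.add ?_ (hF.hasDerivAt_potential hd hu hf.memLp)
    have h1 := ((((hasDerivAt_id (0 : ℝ)).mul_const (inner ℝ u.1.snd φ.1.snd)).const_mul 2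
      |>.const_add (‖u.1.snd‖ ^ 2)).add
        (((hasDerivAt_id (0 : ℝ)).pow 2).mul_const (‖φ.1.snd‖ ^ 2))).const_mul (1 / 2)
    convert! h1 using 1
    simp
  have hloc : IsLocalMin (fun s : ℝ => action F (u + s • φ)) 0 :=
    Eventually.of_forall fun s => by simpa using hmin (u + s • φ)
  have h0 := hloc.hasDerivAt_eq_zero hder
  have hinner : inner ℝ u.1.snd φ.1.snd
      = ∫ t in box T, ∑ α : Fin p, inner ℝ (weakGrad u t α) (pderiv α f t) := by
    rw [L2.inner_def]
    refine integral_congr_ae ?_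
    filter_upwards [hf.memLp_jacobi.coeFn_toLp] with t ht
    have h1 : φ.1.snd t = jacobi f t := ht
    rw [h1, PiLp.inner_apply]
    rfl
  rw [hinner] at h0
  exact eq_neg_of_add_eq_zero_left h0

end IsLipschitzPotential

end PoissonGradient

end

/-! ### The uniform Lipschitz bound, and the theorem. -/

noncomputable section

namespace PoissonGradient

/-- The mean value inequality on the whole of `ℝⁿ`, with `g` and `b` bounded by compactness of the
box. -/
theorem isLipschitzPotential_of_norm_gradient_le {p n : ℕ} {T : Fin p → ℝ}
    {F : (Fin p → ℝ) → E n → ℝ} (hF_meas : ∀ x : E n, AEMeasurable (fun t => F t x) (boxMeasure T))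
    (hF_diff : ∀ t ∈ box T, ContDiff ℝ 1 (F t)) {g b : (Fin p → ℝ) → ℝ}
    (hg : ContinuousOn g (box T)) (hF_bdd : ∀ t ∈ box T, ∀ x : E n, ‖gradient (F t) x‖ ≤ g t)
    (hb : ContinuousOn b (box T)) (hF_zero : ∀ t ∈ box T, |F t 0| ≤ b t) :
    ∃ L M, IsLipschitzPotential T F L M := by
  obtain ⟨C, hC⟩ := (isCompact_Icc (a := (0 : Fin p → ℝ)) (b := T)).exists_bound_of_continuousOn hg
  obtain ⟨M, hM⟩ := (isCompact_Icc (a := (0 : Fin p → ℝ)) (b := T)).exists_bound_of_continuousOn hb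
  -- The signs of `T` are free here, so the box may be empty and `C` negative; `|C|` is a valid
  -- Lipschitz constant in any case.
  refine ⟨|C|, M, hF_meas, fun t ht x y => ?_,
    fun t ht => (hF_zero t ht).trans ((le_abs_self _).trans (hM t ht)), abs_nonneg C⟩
  refine Convex.norm_image_sub_le_of_norm_fderiv_le (𝕜 := ℝ)
    (fun z _ => (hF_diff t ht).differentiable one_ne_zero z) (fun z _ => ?_) convex_univ
    (Set.mem_univ y) (Set.mem_univ x)
  rw [← norm_gradient_eq]
  exact (hF_bdd t ht z).trans ((le_abs_self _).trans ((hC t ht).trans (le_abs_self C)))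

end PoissonGradient

end

open PoissonGradient in
theorem theorem4 (p n : ℕ) (T : Fin p → ℝ) (hT : ∀ i, 0 < T i)
    (F : (Fin p → ℝ) → E n → ℝ)
    -- `F` is measurable in `t` and continuously differentiable in `u`
    (hF_meas : ∀ x : E n, AEMeasurable (fun t => F t x) (boxMeasure T))
    (hF_diff : ∀ t ∈ box T, ContDiff ℝ 1 (F t))
    -- growth of `F` and of its gradient
    (a : ℝ → ℝ) (ha_diff : ContDiffOn ℝ 1 a (Set.Ici 0)) (ha_nonneg : ∀ s, 0 ≤ s → 0 ≤ a s)
    (ha_deriv : ∃ M : ℝ, ∀ s, 0 ≤ s → derivWithin a (Set.Ici 0) s ≤ M)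
    (b : (Fin p → ℝ) → ℝ) (hb_cont : ContinuousOn b (box T)) (hb_nonneg : ∀ t ∈ box T, 0 ≤ b t)
    (hF_growth : ∀ t ∈ box T, ∀ x : E n, |F t x| ≤ a ‖x‖ * b t)
    (hF_grad_growth : ∀ t ∈ box T, ∀ x : E n, ‖gradient (F t) x‖ ≤ a ‖x‖ * b t)
    -- bounded non-linearity
    (g : (Fin p → ℝ) → ℝ) (hg_diff : ContDiffOn ℝ 1 g (box T))
    (hF_bdd : ∀ t ∈ box T, ∀ x : E n, ‖gradient (F t) x‖ ≤ g t)
    -- weak lower semicontinuity of the potential part of the action, on `H¹_T`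
    (hF_wlsc : WeaklyLSC (fun u : H1T n T => potentialAction F u))
    -- coercivity
    (hF_coercive : Tendsto (fun x : E n => ∫ t in box T, F t x) (Bornology.cobounded (E n)) atTop) :
    ∃ u : H1T n T,
      HasWeakLaplacian u (fun t => gradient (F t) (field u t)) ∧
      EqualOnOppositeFaces T (field u) ∧
      (∀ α : Fin p, EqualOnOppositeFaces T (fun t => weakGrad u t α)) ∧
      ∀ w : H1T n T, action F u ≤ action F w := by
  -- The growth condition at `x = 0` supplies the bound `a 0 * b t` at the origin.
  obtain ⟨L, M, hF⟩ := isLipschitzPotential_of_norm_gradient_le hF_meas hF_diff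
    hg_diff.continuousOn hF_bdd (hb_cont.const_mul (a 0))
    (fun t ht => by simpa using hF_growth t ht 0)
  obtain ⟨u, hu⟩ := hF.exists_isMinimizer hT hF_coercive hF_wlsc
  have hfield : MemLp (field u) 2 (boxMeasure T) := Lp.memLp u.1.fst
  have hgrad : MemLp (weakGrad u) 2 (boxMeasure T) := Lp.memLp u.1.snd
  have hweak : HasWeakGradient T (field u) (weakGrad u) := u.2
  have hlap := hF.hasWeakLaplacian_of_isMinimizer hT hF_diff hu
  refine ⟨u, hlap, hweak.equalOnOppositeFaces hT hfield hgrad, fun α => ?_, hu⟩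
  -- The right-hand side of the equation is in `L²`, so elliptic regularity gives `∂u/∂t^α` a weak
  -- gradient of its own.
  obtain ⟨z, hz, hzw⟩ := hweak.exists_hasWeakGradient_of_weakLaplacian hT hfield hgrad hlap.1
    hlap.2 α
  exact hzw.equalOnOppositeFaces hT (hgrad.eval_piLp α) hz
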